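/- Setting. Let $X_1,X_2,\dots$ be data on a probability space with probability $\mathbb P$ (for instance i.i.d. or strictly stationary and ergodic), $\mathbf X_n=(X_1,\dots,X_n)$; all limits are as $n\to\infty$. Let $\Theta$ be a measurable parameter space, $L:\Theta\to\mathbb R$ a population criterion bounded above, with non-empty identified set $\Theta_I=\{\theta\in\Theta: L(\theta)=\sup_{\vartheta\in\Theta} L(\vartheta)\}$. Let $L_n:\Theta\to\mathbb R$ be a sample criterion, jointly measurable in $(\mathbf X_n,\theta)$. Let $\Pi\neq0$ be a prior measure on $\Theta$ (possibly improper), and let $\Pi_n$ be the quasi-posterior, $d\Pi_n(\theta)=e^{nL_n(\theta)}\,d\Pi(\theta)/\int_\Theta e^{nL_n}\,d\Pi$. For $\Theta$-valued $\hat\theta$ put $Q_n(\theta)=2n\,[L_n(\hat\theta)-L_n(\theta)]$. Local reparameterization. Let $d^*\ge1$, let $\Theta_I^N\supseteq\Theta_I$ be a measurable neighborhood of $\Theta_I$, $\Gamma\subseteq\mathbb R^{d^*}$ measurable, and $\gamma:\Theta_I^N\to\Gamma$ measurable with $\gamma(\theta)=0$ if and only if $\theta\in\Theta_I$. Let $(\Theta_{osn})_n$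 be measurable neighborhoods of $\Theta_I$ (only $\Theta_{osn}\supseteq\Theta_I$ is used) with $\Theta_{osn}\subseteq\Theta_I^N$ for all large $n$. Let $T\subseteq\mathbb R^{d^*}$ be a closed convex cone that is covered by the sets $T_{osn}=\{\sqrt n\,\gamma(\theta):\theta\in\Theta_{osn}\}$, that is: (a) $\sup_{\|b\|\le M}\bigl|\inf_{a\in T_{osn}}\|a-b\|^2-\inf_{a\in T}\|a-b\|^2\bigr|\to0$ for each $M$; and (b) for some $k_n\to\infty$ and all large $n$ the sets $C_n=T_{osn}\cap\{x:\|x\|\le k_n\}$ are convex and increasing in $n$, and $T$ is the closure of their union. Suppose moreover that for every $M$ and all large $n$, $\Pi$-almost every $\theta\in\Theta_I^N$ with $\gamma(\theta)\in\gamma(\Theta_{osn})$ and $\sqrt n\,\|\gamma(\theta)\|\le M$ belongs to $\Theta_{osn}$ (this holds for example if $\Theta_{osn}=\{\theta\in\Theta_I^N:\|\gamma(\theta)\|\le r_n/\sqrt n\}$ with $r_n\to\infty$). Write $\mathbf Tv$ for the point of $T$ nearest to $v$, and $F_T(z)=\Pr(\|\mathbf TZ\|^2\le z)$ with $Z\sim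 N(0,I_{d^*})$. Assumptions. (1) (Posterior contraction) $L_n(\hat\theta)=\sup_{\theta\in\Theta_{osn}}L_n(\theta)+o_{\mathbb P}(n^{-1})$ and $\Pi_n(\Theta\setminus\Theta_{osn})=o_{\mathbb P}(1)$. (2) (Local quadratic approximation with $\Sigma=I_{d^*}$) There are measurable functions $\ell_n\in\mathbb R$ and $\hat\gamma_n\in\mathbb R^{d^*}$ of $\mathbf X_n$ and random vectors $\mathbb V_n$ with $$\sup_{\theta\in\Theta_{osn}}\Bigl|nL_n(\theta)-\Bigl(\ell_n+\tfrac12\|\sqrt n\hat\gamma_n\|^2-\tfrac12\|\sqrt n(\hat\gamma_n-\gamma(\theta))\|^2\Bigr)\Bigr|=o_{\mathbb P}(1),$$ $\sup_{\theta\in\Theta_{osn}}\|\gamma(\theta)\|\to0$, $\sqrt n\hat\gamma_n=\mathbf T\mathbb V_n$ almost surely, and $\mathbb V_n\rightsquigarrow N(0,I_{d^*})$. (3) (Prior) For each $n\ge1$, $\int_\Theta e^{nL_n}\,d\Pi<\infty$ almost surely; and for some $\delta>0$ the image under $\gamma$ of $\Pi$ restricted to $\Theta_I^N$ has a continuous,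 strictly positive Lebesgue density on $\{x\in\Gamma:\|x\|<\delta\}$. Procedure 1. Let $\alpha\in(0,1)$, let $\theta^1,\dots,\theta^B\in\Theta$ be Monte Carlo draws ($B$ may depend on $n$), and let $\zeta$ be a $(1-\alpha)$-quantile of $L_n(\theta^1),\dots,L_n(\theta^B)$. Put $\widehat\Theta_\alpha=\{\theta\in\Theta: L_n(\theta)\ge\zeta\}$ and $\xi^{mc}_{n,\alpha}=2n\,[L_n(\hat\theta)-\zeta]$, which is an $\alpha$-quantile of $Q_n(\theta^1),\dots,Q_n(\theta^B)$. Let $\xi^{post}_{n,\alpha}$ be the $\alpha$-quantile of $Q_n(\theta)$ under $\Pi_n$, and assume (4) (MC convergence) $\xi^{mc}_{n,\alpha}=\xi^{post}_{n,\alpha}+o_{\mathbb P}(1)$. Theorem. Under these assumptions, if $F_T$ is continuous at its $\alpha$-quantile $\inf\{c\in\mathbb R:F_T(c)\ge\alpha\}$, then (i) $\liminf_{n\to\infty}\mathbb P(\Theta_I\subseteq\widehat\Theta_\alpha)\ge\alpha$; (ii) if $T=\mathbb R^{d^*}$, then $\lim_{n\to\infty}\mathbb P(\Theta_I\subseteq\widehat\Theta_\alpha)=\alpha$.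 -/

import Mathlib

open MeasureTheory ProbabilityTheory Filter Topology Set
open scoped ENNReal NNReal

noncomputable section

namespace MCConf

/-- `R n = o_P(1)` for errors `R n ω ∈ [0, ∞]`. The measure of a set that is not measurable is its
outer measure, so suprema over uncountable sets need no measurability. -/
def IsOpOne {Ω : Type*} [MeasurableSpace Ω] (P : Measure Ω) (R : ℕ → Ω → ℝ≥0∞) : Prop :=
  ∀ ε : ℝ≥0∞, ε ≠ 0 → Tendsto (fun n => P {ω | ε ≤ R n ω}) atTop (𝓝 0)

/-- Inner probability; it is `P A` when `A` is measurable. -/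
def innerProb {Ω : Type*} [MeasurableSpace Ω] (P : Measure Ω) (A : Set Ω) : ℝ≥0∞ := 1 - P Aᶜ

/-! ### Criterion, quasi-posterior and confidence set -/

/-- The identified set: the maximizers of the population criterion. -/
def identifiedSet {Θ : Type*} (L : Θ → ℝ) : Set Θ := {θ | L θ = ⨆ ϑ, L ϑ}

/-- The sample `(X₁, …, Xₙ)`. -/
def sample {Ω 𝒳 : Type*} (X : ℕ → Ω → 𝒳) (n : ℕ) (ω : Ω) : Fin n → 𝒳 := fun i => X i ω

/-- The sample criterion `Lₙ(θ)`, computed from the sample of size `n`. -/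
def criterion {Ω 𝒳 Θ : Type*} (X : ℕ → Ω → 𝒳) (crit : (n : ℕ) → (Fin n → 𝒳) → Θ → ℝ) (n : ℕ) (ω : Ω) (θ : Θ) : ℝ :=
  crit n (sample X n ω) θ

/-- The quasi-posterior, `dΠₙ(θ) = exp (n Lₙ(θ)) dΠ(θ) / ∫ exp (n Lₙ) dΠ`. -/
def quasiPosterior {Ω Θ : Type*} [MeasurableSpace Θ] (prior : Measure Θ) (Ln : ℕ → Ω → Θ → ℝ) (n : ℕ) (ω : Ω) : Measure Θ :=
  prior.tilted (fun θ => n * Ln n ω θ)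

/-- The quasi-likelihood ratio `Qₙ(θ) = 2n (Lₙ(θ̂) - Lₙ(θ))`. -/
def qlr {Ω Θ : Type*} (Ln : ℕ → Ω → Θ → ℝ) (θhat : ℕ → Ω → Θ) (n : ℕ) (ω : Ω) (θ : Θ) : ℝ :=
  2 * n * (Ln n ω (θhat n ω) - Ln n ω θ)

/-- `z` is a `p`-quantile of the finite list of values `x₁, …, x_B`: at least `p B` of the values
are `≤ z` and at least `(1 - p) B` of them are `≥ z`. -/
def IsSampleQuantile {B : ℕ} (p : ℝ) (x : Fin B → ℝ) (z : ℝ) : Prop :=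
  p * B ≤ Nat.card {b // x b ≤ z} ∧ (1 - p) * B ≤ Nat.card {b // z ≤ x b}

/-- The Procedure 1 confidence set: the upper contour set of `Lₙ` at the critical value `ζ`. -/
def confidenceSet {Ω Θ : Type*} (Ln : ℕ → Ω → Θ → ℝ) (ζ : ℕ → Ω → ℝ) (n : ℕ) (ω : Ω) : Set Θ :=
  {θ | ζ n ω ≤ Ln n ω θ}

/-- The critical value `ζ` for `Lₙ`, expressed on the scale of the quasi-likelihood ratio. -/
def qlrCritical {Ω Θ : Type*} (Ln : ℕ → Ω → Θ → ℝ) (θhat : ℕ → Ω → Θ) (ζ : ℕ → Ω → ℝ) (n : ℕ) (ω : Ω) : ℝ :=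
  2 * n * (Ln n ω (θhat n ω) - ζ n ω)

/-- If `ζ` is a `(1 - α)`-quantile of the criterion at the draws, then `qlrCritical` is an
`α`-quantile of the quasi-likelihood ratio at the draws. -/
theorem isSampleQuantile_qlrCritical {Ω Θ : Type*} {B : ℕ} {α : ℝ} {n : ℕ} (hn : 1 ≤ n) {ω : Ω}
    (Ln : ℕ → Ω → Θ → ℝ) (θhat : ℕ → Ω → Θ) (ζ : ℕ → Ω → ℝ) (draw : Fin B → Θ)
    (h : IsSampleQuantile (1 - α) (fun b => Ln n ω (draw b)) (ζ n ω)) :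
    IsSampleQuantile α (fun b => qlr Ln θhat n ω (draw b)) (qlrCritical Ln θhat ζ n ω) := by
  have hn' : (0 : ℝ) < 2 * n := by positivity
  obtain ⟨h1, h2⟩ := h
  simp only [IsSampleQuantile, qlr, qlrCritical, mul_le_mul_iff_right₀ hn', sub_le_sub_iff_left]
  exact ⟨by simpa using h2, h1⟩

/-- The `α`-quantile of a distribution function `F`. -/
def cdfQuantile (F : ℝ → ℝ) (α : ℝ) : ℝ := sInf {c | α ≤ F c}

/-- The `α`-quantile of the quasi-likelihood ratio under the quasi-posterior. -/
def postQuantile {Ω Θ : Type*} [MeasurableSpace Θ] (prior : Measure Θ) (Ln : ℕ → Ω → Θ → ℝ) (θhat : ℕ → Ω → Θ) (α : ℝ)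
    (n : ℕ) (ω : Ω) : ℝ :=
  cdfQuantile (fun z => (quasiPosterior prior Ln n ω).real {θ | qlr Ln θhat n ω θ ≤ z}) α

/-! ### Cones -/

open Classical in
/-- The metric projection of `v` onto `T`: the point of `T` nearest to `v` (it exists and is
unique when `T` is nonempty, closed and convex). -/
def metricProj {d : ℕ} (T : Set (EuclideanSpace ℝ (Fin d))) (v : EuclideanSpace ℝ (Fin d)) :
    EuclideanSpace ℝ (Fin d) :=
  if h : ∃ t ∈ T, ∀ s ∈ T, ‖v - t‖ ≤ ‖v - s‖ then h.choose else 0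

/-- `F_T(z) = Pr(‖𝐓Z‖² ≤ z)` for `Z ~ N(0, I_d)`. -/
def coneCdf {d : ℕ} (T : Set (EuclideanSpace ℝ (Fin d))) (z : ℝ) : ℝ :=
  (stdGaussian (EuclideanSpace ℝ (Fin d))).real {v | ‖metricProj T v‖ ^ 2 ≤ z}

/-- The sets `A n` cover `T`. -/
def Covers {d : ℕ} (A : ℕ → Set (EuclideanSpace ℝ (Fin d)))
    (T : Set (EuclideanSpace ℝ (Fin d))) : Prop :=
  (∀ M : ℝ, TendstoUniformlyOn (fun n b => Metric.infDist b (A n) ^ 2)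
      (fun b => Metric.infDist b T ^ 2) atTop (Metric.closedBall 0 M)) ∧
  ∃ k : ℕ → ℝ, Tendsto k atTop atTop ∧ ∃ N : ℕ,
    (∀ n ≥ N, Convex ℝ (A n ∩ Metric.closedBall 0 (k n))) ∧
    (∀ n ≥ N, ∀ n' ≥ n, A n ∩ Metric.closedBall 0 (k n) ⊆ A n' ∩ Metric.closedBall 0 (k n')) ∧
    T = closure (⋃ n ≥ N, A n ∩ Metric.closedBall 0 (k n))

/-! ### Assumptions -/

/-- `γ` is a local reduced-form reparameterization on `ΘN ⊇ Θ_I` with values in `Γ`. -/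
structure IsLocalReparam {Θ : Type*} [MeasurableSpace Θ] {d : ℕ} (ΘI ΘN : Set Θ) (γ : Θ → EuclideanSpace ℝ (Fin d))
    (Γ : Set (EuclideanSpace ℝ (Fin d))) : Prop where
  measurableSet_nhd : MeasurableSet ΘN
  subset_nhd : ΘI ⊆ ΘN
  measurable : Measurable (ΘN.domRestrict γ)
  measurableSet_range : MeasurableSet Γ
  mapsTo : MapsTo γ ΘN Γ
  eq_zero_iff : ∀ θ ∈ ΘN, γ θ = 0 ↔ θ ∈ ΘI

/-- `Θosn` is a sequence of local neighborhoods of `Θ_I` inside `ΘN`: measurable supersets of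
`Θ_I`, eventually contained in `ΘN`, on which `γ` tends to zero uniformly, such that
`{√n γ(θ) : θ ∈ Θosn n}` covers `T`. Moreover, near zero on the scale `1/√n`, `Θosn n` is
`prior`-almost everywhere a union of level sets of `γ` in `ΘN`. -/
structure IsLocalNhds {Θ : Type*} [MeasurableSpace Θ] {d : ℕ} (prior : Measure Θ) (ΘI ΘN : Set Θ)
    (γ : Θ → EuclideanSpace ℝ (Fin d)) (T : Set (EuclideanSpace ℝ (Fin d)))
    (Θosn : ℕ → Set Θ) : Prop where
  measurableSet : ∀ n ≥ 1, MeasurableSet (Θosn n)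
  subset : ∀ n ≥ 1, ΘI ⊆ Θosn n
  subset_nhd : ∀ᶠ n in atTop, Θosn n ⊆ ΘN
  tendsto_zero : Tendsto (fun n => ⨆ θ ∈ Θosn n, ‖γ θ‖ₑ) atTop (𝓝 0)
  covers : Covers (fun n => (fun θ => √(n : ℝ) • γ θ) '' Θosn n) T
  saturated : ∀ M : ℝ, ∀ᶠ n : ℕ in atTop, ∀ᵐ θ ∂prior,
    θ ∈ ΘN → γ θ ∈ γ '' Θosn n → √(n : ℝ) * ‖γ θ‖ ≤ M → θ ∈ Θosn n

/-- Posterior contraction: `Lₙ(θ̂) = sup_{Θosn} Lₙ + o_P(1/n)` and `Πₙ(Θosnᶜ) = o_P(1)`. The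
supremum is taken in the extended reals. -/
structure PosteriorContraction {Ω Θ : Type*} [MeasurableSpace Ω] [MeasurableSpace Θ]
    (P : Measure Ω) (prior : Measure Θ) (Ln : ℕ → Ω → Θ → ℝ)
    (θhat : ℕ → Ω → Θ) (Θosn : ℕ → Set Θ) : Prop where
  approx_max : IsOpOne P fun n ω =>
    ((n : EReal) * ((Ln n ω (θhat n ω) : EReal) - ⨆ θ ∈ Θosn n, (Ln n ω θ : EReal))).abs
  contraction : IsOpOne P fun n ω => quasiPosterior prior Ln n ω (Θosn n)ᶜ

/-- Local quadratic approximation with limiting covariance matrix `S`; the random variables `ℓ` and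
`γhat` are functions of the sample. -/
def LocalQuadraticApprox {Ω 𝒳 Θ : Type*} [MeasurableSpace Ω] [MeasurableSpace 𝒳]
    {d : ℕ} (P : Measure Ω) [IsProbabilityMeasure P] (X : ℕ → Ω → 𝒳)
    (crit : (n : ℕ) → (Fin n → 𝒳) → Θ → ℝ) (γ : Θ → EuclideanSpace ℝ (Fin d))
    (T : Set (EuclideanSpace ℝ (Fin d))) (Θosn : ℕ → Set Θ) (S : Matrix (Fin d) (Fin d) ℝ) : Prop :=
  ∃ (ℓ : (n : ℕ) → (Fin n → 𝒳) → ℝ) (γhat : (n : ℕ) → (Fin n → 𝒳) → EuclideanSpace ℝ (Fin d))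
    (V : ℕ → Ω → EuclideanSpace ℝ (Fin d)),
    (∀ n, Measurable (ℓ n)) ∧ (∀ n, Measurable (γhat n)) ∧
    (IsOpOne P fun n ω => ⨆ θ ∈ Θosn n,
      ‖n * criterion X crit n ω θ - (ℓ n (sample X n ω)
          + 1 / 2 * ‖√(n : ℝ) • γhat n (sample X n ω)‖ ^ 2
          - 1 / 2 * ‖√(n : ℝ) • (γhat n (sample X n ω) - γ θ)‖ ^ 2)‖ₑ) ∧
    (∀ n : ℕ, 1 ≤ n → ∀ᵐ ω ∂P, √(n : ℝ) • γhat n (sample X n ω) = metricProj T (V n ω)) ∧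
    TendstoInDistribution V atTop id (fun _ => P) (multivariateGaussian 0 S)

/-- Prior: the quasi-posterior is proper, and the image under `γ` of the prior on `ΘN` has a
continuous, strictly positive Lebesgue density on `B_δ ∩ Γ` for some `δ > 0`. -/
structure PriorCondition {Ω Θ : Type*} [MeasurableSpace Ω] [MeasurableSpace Θ]
    {d : ℕ} (P : Measure Ω) (prior : Measure Θ) (Ln : ℕ → Ω → Θ → ℝ)
    (ΘN : Set Θ) (γ : Θ → EuclideanSpace ℝ (Fin d)) (Γ : Set (EuclideanSpace ℝ (Fin d))) :
    Prop where
  proper : ∀ n ≥ 1, ∀ᵐ ω ∂P, Integrable (fun θ => Real.exp (n * Ln n ω θ)) prior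
  density : ∃ δ > 0, ∃ π : EuclideanSpace ℝ (Fin d) → ℝ,
    ContinuousOn π (Metric.ball 0 δ ∩ Γ) ∧ (∀ x ∈ Metric.ball 0 δ ∩ Γ, 0 < π x) ∧
    ((prior.restrict ΘN).map γ).restrict (Metric.ball 0 δ ∩ Γ) =
      (volume.restrict (Metric.ball 0 δ ∩ Γ)).withDensity fun x => ENNReal.ofReal (π x)

/-- Monte Carlo convergence: the critical value computed from the draws agrees, on the scale of the
quasi-likelihood ratio, with the posterior `α`-quantile up to `o_P(1)`. -/
def MCConvergence {Ω Θ : Type*} [MeasurableSpace Ω] [MeasurableSpace Θ]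
    (P : Measure Ω) (prior : Measure Θ) (Ln : ℕ → Ω → Θ → ℝ) (θhat : ℕ → Ω → Θ)
    (ζ : ℕ → Ω → ℝ) (α : ℝ) : Prop :=
  IsOpOne P fun n ω => ‖qlrCritical Ln θhat ζ n ω - postQuantile prior Ln θhat α n ω‖ₑ

end MCConf

end

set_option linter.unusedSectionVars false

/-! On `Θosn` the criterion is quadratic in `√n γ(θ)`, and the prior is flat at scale `1/√n`. The
quasi-posterior law of `√n γ(θ)` is therefore close to `N(v, I)` conditioned on `T`, with `v = 𝐓Vₙ ∈
T`, and the quasi-likelihood ratio is close to `‖√n γ(θ) - v‖²`. Its posterior distribution function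
at `c` is thus about `Pr(‖Z‖² ≤ c | Z ∈ T - v)`. On the identified set `γ = 0`, so there the ratio
is uniformly close to `‖𝐓Vₙ‖²`, which has limit law `F_T`. Coverage at least `α` follows once the
posterior quantile is asymptotically no smaller than the quantile of `F_T`, that is, once `Pr(‖Z‖² ≤
c | Z ∈ T - v) ≤ F_T(c)` for every `v ∈ T`. If `T` is the whole space, the two sides agree and
coverage is exact.

The conditional inequality is `stdGaussian_translate_cone_le`. Since `‖𝐓z‖ ≤ ‖z‖`, the ball lies in
`{‖𝐓z‖ ≤ √c}`. The outward normals of that convex set lie in `T`, those of `T - v` in the polar cone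
of `T`, so any two of them form an obtuse angle. For such pairs of closed convex sets the Gaussian
measure of the intersection is at most the product of the measures (`stdGaussian_inter_le`): smooth
both indicators and interpolate between a Gaussian vector and an independent copy.

The posterior approximation (`eventually_setLIntegral_shiftDensity_le`,
`tilted_apply_le_of_quadratic`) is made uniform over `v ∈ T` with `‖v‖ ≤ M`. It then applies
deterministically on an event of probability close to one (`exists_eventually_measure_not_good`),
and the portmanteau theorem finishes the argument. All probabilities of possibly non-measurable
events are outer measures. -/

namespace MCConf

/-! ### Density of the standard Gaussian and Stein's identity. -/

section GaussianDensity

variable {E : Type*} [NormedAddCommGroup E] [InnerProductSpace ℝ E] [FiniteDimensional ℝ E]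
  [MeasurableSpace E] [BorelSpace E]

variable (E) in
/-- The normalizing constant of the standard Gaussian density. -/
noncomputable def gaussConst : ℝ := ((2 * Real.pi) ^ (Module.finrank ℝ E / 2 : ℝ))⁻¹

variable (E) in
theorem gaussConst_pos : 0 < gaussConst E := by unfold gaussConst; positivity

/-- The density of the standard Gaussian distribution. -/
noncomputable def gaussDensity (x : E) : ℝ := gaussConst E * Real.exp (-(1 / 2) * ‖x‖ ^ 2)

theorem gaussDensity_pos (x : E) : 0 < gaussDensity x :=
  mul_pos (gaussConst_pos E) (Real.exp_pos _)

theorem continuous_gaussDensity : Continuous (gaussDensity (E := E)) := by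
  unfold gaussDensity; fun_prop

theorem integrable_exp_neg_mul_sq_norm {b : ℝ} (hb : 0 < b) :
    Integrable (fun x : E => Real.exp (-b * ‖x‖ ^ 2)) := by
  have h := (GaussianFourier.integrable_cexp_neg_mul_sq_norm_add (V := E) (b := (b : ℂ))
    (by simpa using hb) 0 0).norm
  refine h.congr (ae_of_all _ fun x => ?_)
  simp [Complex.norm_exp, ← Complex.ofReal_pow]

theorem integrable_gaussDensity : Integrable (gaussDensity (E := E)) :=
  (integrable_exp_neg_mul_sq_norm (by norm_num)).const_mul _

/-- Both measures are finite, so it is enough to compare characteristic functions; that of the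
density is the Gaussian Fourier integral. -/
theorem stdGaussian_eq_withDensity :
    stdGaussian E = volume.withDensity fun x => ENNReal.ofReal (gaussDensity x) := by
  have : IsFiniteMeasure (volume.withDensity fun x : E => ENNReal.ofReal (gaussDensity x)) :=
    isFiniteMeasure_withDensity_ofReal integrable_gaussDensity.2
  apply Measure.ext_of_charFun
  ext t
  rw [charFun_stdGaussian, charFun_apply, integral_withDensity_eq_integral_toReal_smul
    (by have := continuous_gaussDensity (E := E); fun_prop) (by simp)]
  have h := GaussianFourier.integral_cexp_neg_mul_sq_norm_add (V := E) (b := (1 / 2 : ℂ))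
    (by norm_num) Complex.I t
  have h2 : ∀ x : E, (ENNReal.ofReal (gaussDensity x)).toReal
      • Complex.exp (((inner ℝ x t : ℝ) : ℂ) * Complex.I)
      = (gaussConst E : ℂ) * Complex.exp (-(1/2:ℂ) * ‖x‖ ^ 2 + Complex.I * (inner ℝ t x : ℝ)) := by
    intro x
    rw [ENNReal.toReal_ofReal (gaussDensity_pos x).le, gaussDensity, Complex.exp_add,
      real_inner_comm x t, Complex.real_smul]
    push_cast
    ring_nf
  simp_rw [h2]
  rw [integral_const_mul, h, gaussConst]
  have h3 : (((2 * Real.pi) ^ (Module.finrank ℝ E / 2 : ℝ) : ℝ) : ℂ)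
      = (Real.pi / (1 / 2 : ℂ)) ^ (Module.finrank ℝ E / 2 : ℂ) := by
    rw [Complex.ofReal_cpow (by positivity)]
    push_cast
    congr 1
    ring
  rw [Complex.ofReal_inv, h3, ← mul_assoc, inv_mul_cancel₀, one_mul]
  · simp; ring_nf
  · rw [← h3]
    exact_mod_cast (by positivity : (0:ℝ) < (2 * Real.pi) ^ (Module.finrank ℝ E / 2 : ℝ)).ne'

theorem integral_stdGaussian (h : E → ℝ) :
    ∫ x, h x ∂(stdGaussian E) = ∫ x, gaussDensity x * h x := by
  rw [stdGaussian_eq_withDensity, integral_withDensity_eq_integral_toReal_smul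
    (by have := continuous_gaussDensity (E := E); fun_prop) (by simp)]
  simp [ENNReal.toReal_ofReal (gaussDensity_pos _).le]

theorem integrable_stdGaussian_iff {h : E → ℝ} :
    Integrable h (stdGaussian E) ↔ Integrable fun x => gaussDensity x * h x := by
  rw [stdGaussian_eq_withDensity, integrable_withDensity_iff_integrable_smul'
    (by have := continuous_gaussDensity (E := E); fun_prop) (by simp)]
  simp [ENNReal.toReal_ofReal (gaussDensity_pos _).le]

theorem hasFDerivAt_gaussDensity (x : E) :
    HasFDerivAt gaussDensity (-gaussDensity x • innerSL ℝ x) x := by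
  have h1 : HasFDerivAt (fun x : E => ‖x‖ ^ 2) (2 • innerSL ℝ x) x :=
    (hasStrictFDerivAt_norm_sq x).hasFDerivAt
  have h2 := ((h1.const_mul (-(1/2))).exp).const_mul (gaussConst E)
  convert! h2 using 1
  ext y
  simp [gaussDensity]
  ring

/-- **Stein's identity.** -/
theorem integral_mul_inner_stdGaussian {h : E → ℝ} (hd : Differentiable ℝ h) {C : ℝ}
    (hC : ∀ x, |h x| ≤ C) (hC' : ∀ x, ‖fderiv ℝ h x‖ ≤ C) (u : E) :
    ∫ x, h x * inner ℝ u x ∂(stdGaussian E) = ∫ x, fderiv ℝ h x u ∂(stdGaussian E) := by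
  have hp : ∀ x : E, fderiv ℝ gaussDensity x u = -(gaussDensity x * inner ℝ u x) := fun x => by
    rw [(hasFDerivAt_gaussDensity x).fderiv]
    simp [real_inner_comm]
  have hid : Integrable (fun x : E => inner ℝ u x) (stdGaussian E) :=
    (IsGaussian.integrable_id (μ := stdGaussian E)).const_inner u
  have hbd : Integrable (fun x => h x * inner ℝ u x) (stdGaussian E) :=
    hid.bdd_mul hd.continuous.aestronglyMeasurable (ae_of_all _ hC)
  have hder : Integrable (fun x => fderiv ℝ h x u) (stdGaussian E) := by
    refine Integrable.of_bound (measurable_fderiv_apply_const ℝ h u).aestronglyMeasurable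
      (C * ‖u‖) (ae_of_all _ fun x => ?_)
    exact (ContinuousLinearMap.le_opNorm _ _).trans (by gcongr; exact hC' x)
  have hh : Integrable h (stdGaussian E) :=
    Integrable.of_bound hd.continuous.aestronglyMeasurable C (ae_of_all _ hC)
  rw [integrable_stdGaussian_iff] at hbd hder hh
  -- Integration by parts: the derivative of the Gaussian density along `u` is `-⟨u, x⟩` times the
  -- density.
  have key := integral_mul_fderiv_eq_neg_fderiv_mul_of_integrable (f := h) (g := gaussDensity (E := E))
    (v := u) (μ := volume) (by simpa [mul_comm] using hder)
    (by simp_rw [hp]; refine hbd.neg.congr (ae_of_all _ fun x => ?_); simp; ring)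
    (by simpa [mul_comm] using hh) (fun x _ => hd x)
    (fun x _ => (hasFDerivAt_gaussDensity x).differentiableAt)
  simp_rw [hp] at key
  rw [integral_stdGaussian, integral_stdGaussian]
  calc _ = -∫ x, h x * -(gaussDensity x * inner ℝ u x) := by
        rw [← integral_neg]; congr 1; ext x; ring
    _ = _ := by rw [key, neg_neg]; congr 1; ext x; ring

end GaussianDensity

/-! ### Negative correlation by Gaussian interpolation. -/

section Covariance

variable {E : Type*} [NormedAddCommGroup E] [InnerProductSpace ℝ E] [FiniteDimensional ℝ E]
  [MeasurableSpace E] [BorelSpace E]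

/-- The derivative of the Gaussian interpolation `E f(X) g(cos t X + sin t Y)` between `E f(X) g(X)`
and `E f(X) g(Y)`. -/
theorem integral_interpolation_deriv {f : E → ℝ} {F G : E → E}
    (hf : ∀ x, HasFDerivAt f (innerSL ℝ (F x)) x) (hGc : Continuous G)
    {C : ℝ} (hfC : ∀ x, |f x| ≤ C) (hFC : ∀ x, ‖F x‖ ≤ C) (hGC : ∀ x, ‖G x‖ ≤ C) (t : ℝ) :
    ∫ z : E × E, f z.1 * inner ℝ (G (Real.cos t • z.1 + Real.sin t • z.2))
        (-Real.sin t • z.1 + Real.cos t • z.2) ∂((stdGaussian E).prod (stdGaussian E))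
      = -Real.sin t * ∫ x, ∫ y, inner ℝ (F (Real.cos t • x - Real.sin t • y)) (G x)
          ∂(stdGaussian E) ∂(stdGaussian E) := by
  have hfcont : Continuous f := continuous_iff_continuousAt.2 fun x => (hf x).continuousAt
  -- Rotation invariance makes `cos t X + sin t Y` and `-sin t X + cos t Y` the independent
  -- coordinates; Stein's identity then removes the linear factor in the second one.
  have hrot := IsGaussian.map_rotation_eq_self (μ := stdGaussian E) (by simp) t
  set γ := stdGaussian E
  have hmeas : Measurable (ContinuousLinearMap.rotation (E := E) t) :=
    (ContinuousLinearMap.rotation t).continuous.measurable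
  have hCnn : 0 ≤ C := (abs_nonneg _).trans (hfC 0)
  have hcont : Continuous fun z : E × E =>
      f (Real.cos t • z.1 - Real.sin t • z.2) * inner ℝ (G z.1) z.2 := by fun_prop
  have hint : Integrable (fun z : E × E =>
      f (Real.cos t • z.1 - Real.sin t • z.2) * inner ℝ (G z.1) z.2) (γ.prod γ) := by
    have h2 : Integrable (fun z : E × E => z.2) (γ.prod γ) :=
      (IsGaussian.integrable_id (μ := γ)).comp_snd γ
    refine (h2.norm.const_mul (C * C)).mono' hcont.aestronglyMeasurable (ae_of_all _ fun z => ?_)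
    rw [norm_mul, mul_assoc]
    exact mul_le_mul (hfC _) ((norm_inner_le_norm _ _).trans (by gcongr; exact hGC _))
      (norm_nonneg _) hCnn
  calc _ = ∫ z : E × E, f (Real.cos t • z.1 - Real.sin t • z.2) * inner ℝ (G z.1) z.2
          ∂((γ.prod γ).map (ContinuousLinearMap.rotation t)) := by
        rw [integral_map hmeas.aemeasurable hcont.aestronglyMeasurable]
        congr 1
        ext z
        simp only [ContinuousLinearMap.rotation_apply]
        congr 2
        have : Real.cos t • (Real.cos t • z.1 + Real.sin t • z.2)
            - Real.sin t • (-Real.sin t • z.1 + Real.cos t • z.2)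
            = (Real.cos t ^ 2 + Real.sin t ^ 2) • z.1 := by module
        rw [this, Real.cos_sq_add_sin_sq, one_smul]
    _ = ∫ z : E × E, f (Real.cos t • z.1 - Real.sin t • z.2) * inner ℝ (G z.1) z.2 ∂(γ.prod γ) := by
        rw [hrot]
    _ = ∫ x, ∫ y, f (Real.cos t • x - Real.sin t • y) * inner ℝ (G x) y ∂γ ∂γ :=
        integral_prod _ hint
    _ = ∫ x, -Real.sin t * ∫ y, inner ℝ (F (Real.cos t • x - Real.sin t • y)) (G x) ∂γ ∂γ := by
        congr 1
        ext x
        have hd : ∀ y, HasFDerivAt (fun y => f (Real.cos t • x - Real.sin t • y))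
            (-Real.sin t • innerSL ℝ (F (Real.cos t • x - Real.sin t • y))) y := fun y => by
          have h1 : HasFDerivAt (fun y : E => Real.cos t • x - Real.sin t • y)
              (-(Real.sin t • ContinuousLinearMap.id ℝ E)) y :=
            ((hasFDerivAt_id y).const_smul (Real.sin t)).const_sub _
          convert! (hf _).comp y h1 using 1
          ext w
          simp
        rw [integral_mul_inner_stdGaussian (C := C) (fun y => (hd y).differentiableAt)
          (fun y => hfC _) (fun y => ?_), ← integral_const_mul]
        · congr 1
          ext y
          rw [(hd y).fderiv]
          simp
        · rw [(hd y).fderiv, norm_smul, innerSL_apply_norm, norm_neg]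
          calc _ ≤ 1 * C := by
                gcongr
                · exact Real.abs_sin_le_one t
                · exact hFC _
            _ = C := one_mul C
    _ = _ := integral_const_mul _ _

theorem hasDerivAt_interpolation {f g : E → ℝ} {G : E → E} (hfc : Continuous f)
    (hg : ∀ x, HasFDerivAt g (innerSL ℝ (G x)) x) (hGc : Continuous G)
    {C : ℝ} (hfC : ∀ x, |f x| ≤ C) (hgC : ∀ x, |g x| ≤ C) (hGC : ∀ x, ‖G x‖ ≤ C) (t : ℝ) :
    HasDerivAt (fun t => ∫ z : E × E, f z.1 * g (Real.cos t • z.1 + Real.sin t • z.2)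
        ∂((stdGaussian E).prod (stdGaussian E)))
      (∫ z : E × E, f z.1 * inner ℝ (G (Real.cos t • z.1 + Real.sin t • z.2))
        (-Real.sin t • z.1 + Real.cos t • z.2) ∂((stdGaussian E).prod (stdGaussian E))) t := by
  have hgcont : Continuous g := continuous_iff_continuousAt.2 fun x => (hg x).continuousAt
  set γ := stdGaussian E
  have hCnn : 0 ≤ C := (abs_nonneg _).trans (hfC 0)
  have h1 : Integrable (fun z : E × E => z.1) (γ.prod γ) :=
    (IsGaussian.integrable_id (μ := γ)).comp_fst γ
  have h2 : Integrable (fun z : E × E => z.2) (γ.prod γ) :=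
    (IsGaussian.integrable_id (μ := γ)).comp_snd γ
  refine (hasDerivAt_integral_of_dominated_loc_of_deriv_le (s := univ)
    (bound := fun z : E × E => C * (C * (‖z.1‖ + ‖z.2‖)))
    (F' := fun t (z : E × E) => f z.1 * inner ℝ (G (Real.cos t • z.1 + Real.sin t • z.2))
        (-Real.sin t • z.1 + Real.cos t • z.2)) univ_mem ?_ ?_ ?_ ?_ ?_ ?_).2
  · exact Eventually.of_forall fun t => Continuous.aestronglyMeasurable (by fun_prop)
  · refine Integrable.of_bound (Continuous.aestronglyMeasurable (by fun_prop)) (C * C)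
      (ae_of_all _ fun z => ?_)
    rw [norm_mul]
    exact mul_le_mul (hfC _) (hgC _) (norm_nonneg _) hCnn
  · exact Continuous.aestronglyMeasurable (by fun_prop)
  · refine ae_of_all _ fun z t _ => ?_
    rw [norm_mul]
    refine mul_le_mul (hfC _) ((norm_inner_le_norm _ _).trans ?_) (norm_nonneg _) hCnn
    refine mul_le_mul (hGC _) ((norm_add_le _ _).trans ?_) (norm_nonneg _) hCnn
    rw [norm_smul, norm_smul, norm_neg]
    gcongr
    · exact mul_le_of_le_one_left (norm_nonneg _) (Real.abs_sin_le_one t)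
    · exact mul_le_of_le_one_left (norm_nonneg _) (Real.abs_cos_le_one t)
  · exact ((h1.norm.add h2.norm).const_mul C).const_mul C
  · refine ae_of_all _ fun z t _ => ?_
    have hz : HasDerivAt (fun t => Real.cos t • z.1 + Real.sin t • z.2)
        (-Real.sin t • z.1 + Real.cos t • z.2) t :=
      ((Real.hasDerivAt_cos t).smul_const _).add ((Real.hasDerivAt_sin t).smul_const _)
    have := ((hg _).comp_hasDerivAt t hz).const_mul (f z.1)
    simpa using this

/-- Two functions whose gradients form obtuse angles are negatively correlated under the standard
Gaussian distribution. -/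
theorem integral_mul_le_of_inner_grad_nonpos {f g : E → ℝ} {F G : E → E}
    (hf : ∀ x, HasFDerivAt f (innerSL ℝ (F x)) x) (hg : ∀ x, HasFDerivAt g (innerSL ℝ (G x)) x)
    (hGc : Continuous G) {C : ℝ}
    (hfC : ∀ x, |f x| ≤ C) (hgC : ∀ x, |g x| ≤ C) (hFC : ∀ x, ‖F x‖ ≤ C) (hGC : ∀ x, ‖G x‖ ≤ C)
    (hFG : ∀ x y, inner ℝ (F x) (G y) ≤ 0) :
    ∫ x, f x * g x ∂(stdGaussian E)
      ≤ (∫ x, f x ∂(stdGaussian E)) * ∫ x, g x ∂(stdGaussian E) := by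
  have hfcont : Continuous f := continuous_iff_continuousAt.2 fun x => (hf x).continuousAt
  have hder := hasDerivAt_interpolation hfcont hg hGc hfC hgC hGC
  -- On `[0, π/2]` the derivative is `-sin t` times an average of nonpositive inner products. The
  -- endpoints give `E fg` at `0` and `E f · E g` at `π/2`.
  have hmono : MonotoneOn (fun t => ∫ z : E × E, f z.1 * g (Real.cos t • z.1 + Real.sin t • z.2)
        ∂((stdGaussian E).prod (stdGaussian E))) (Icc 0 (Real.pi / 2)) := by
    refine monotoneOn_of_deriv_nonneg (convex_Icc _ _)
      (fun t _ => (hder t).continuousAt.continuousWithinAt)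
      (fun t _ => (hder t).differentiableAt.differentiableWithinAt) fun t ht => ?_
    rw [interior_Icc] at ht
    rw [(hder t).deriv, integral_interpolation_deriv hf hGc hfC hFC hGC]
    refine mul_nonneg_of_nonpos_of_nonpos ?_ (integral_nonpos fun x => integral_nonpos fun y => hFG _ _)
    have := Real.sin_nonneg_of_nonneg_of_le_pi ht.1.le (by linarith [ht.2, Real.pi_pos])
    linarith
  have h := hmono (left_mem_Icc.2 (by positivity)) (right_mem_Icc.2 (by positivity))
    (by positivity : (0 : ℝ) ≤ Real.pi / 2)
  simp only [Real.cos_zero, Real.sin_zero, one_smul, zero_smul, add_zero, Real.cos_pi_div_two,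
    Real.sin_pi_div_two, zero_add] at h
  rw [integral_prod_mul f g, integral_fun_fst (fun x => f x * g x)] at h
  simpa using h

end Covariance

/-! ### Projections onto convex sets and the reverse correlation inequality. -/

section Convex

variable {E : Type*} [NormedAddCommGroup E] [InnerProductSpace ℝ E]

/-- `p` is the metric projection onto the convex set `K`. -/
structure IsProj (K : Set E) (p : E → E) : Prop where
  mem : ∀ x, p x ∈ K
  inner_le : ∀ x, ∀ y ∈ K, inner ℝ (x - p x) (y - p x) ≤ 0

theorem exists_isProj [CompleteSpace E] {K : Set E} (hne : K.Nonempty) (hcl : IsClosed K)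
    (hcv : Convex ℝ K) : ∃ p, IsProj K p := by
  choose p hp hp' using exists_norm_eq_iInf_of_complete_convex hne hcl.isComplete hcv
  exact ⟨p, hp, fun x => (norm_eq_iInf_iff_real_inner_le_zero hcv (hp x)).1 (hp' x)⟩

namespace IsProj

variable {K : Set E} {p : E → E} (hp : IsProj K p)
include hp

theorem norm_sub_le (x y : E) : ‖p x - p y‖ ≤ ‖x - y‖ := by
  have h1 := hp.inner_le x _ (hp.mem y)
  have h2 := hp.inner_le y _ (hp.mem x)
  have h3 : ‖p x - p y‖ ^ 2 ≤ inner ℝ (x - y) (p x - p y) := by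
    have e : inner ℝ (x - y) (p x - p y) - ‖p x - p y‖ ^ 2
        = -inner ℝ (x - p x) (p y - p x) - inner ℝ (y - p y) (p x - p y) := by
      rw [← real_inner_self_eq_norm_sq]
      simp only [inner_sub_left, inner_sub_right]
      ring
    linarith
  have h4 := h3.trans (real_inner_le_norm _ _)
  by_contra! h
  nlinarith [norm_nonneg (x - y), norm_nonneg (p x - p y)]

theorem continuous : Continuous p :=
  (LipschitzWith.of_dist_le_mul (K := 1) fun x y => by
    simpa [dist_eq_norm] using hp.norm_sub_le x y).continuous

theorem norm_sub_le_of_mem (x : E) {y : E} (hy : y ∈ K) : ‖x - p x‖ ≤ ‖x - y‖ := by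
  have h1 := hp.inner_le x y hy
  have e : ‖x - y‖ ^ 2 = ‖x - p x‖ ^ 2 - 2 * inner ℝ (x - p x) (y - p x) + ‖y - p x‖ ^ 2 := by
    rw [← norm_sub_sq_real]; congr 2; abel
  by_contra! h
  nlinarith [norm_nonneg (x - y), sq_nonneg ‖y - p x‖]

theorem eq_self_of_mem {x : E} (hx : x ∈ K) : p x = x := by
  have := hp.norm_sub_le_of_mem x hx
  rw [sub_self, norm_zero] at this
  exact (sub_eq_zero.1 (norm_le_zero_iff.1 this)).symm

/-- Using `p x` as a competitor for `x + h` bounds the increment above; using `p (x + h)` as a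
competitor for `x`, with nonexpansiveness, bounds it below. Both remainders are at most `‖h‖²`, so
no smoothness of `p` is needed. -/
theorem hasFDerivAt_sq (x : E) :
    HasFDerivAt (fun x => ‖x - p x‖ ^ 2) (innerSL ℝ ((2 : ℝ) • (x - p x))) x := by
  rw [hasFDerivAt_iff_isLittleO_nhds_zero]
  have hb : ∀ h : E, ‖‖x + h - p (x + h)‖ ^ 2 - ‖x - p x‖ ^ 2
      - innerSL ℝ ((2 : ℝ) • (x - p x)) h‖ ≤ 1 * ‖‖h‖ ^ 2‖ := by
    intro h
    have up : ‖x + h - p (x + h)‖ ^ 2 ≤ ‖x - p x‖ ^ 2 + 2 * inner ℝ (x - p x) h + ‖h‖ ^ 2 := by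
      rw [← norm_add_sq_real]
      have := hp.norm_sub_le_of_mem (x + h) (hp.mem x)
      rw [show x - p x + h = x + h - p x by abel]
      gcongr
    have lo : ‖x - p x‖ ^ 2 + 2 * inner ℝ (x - p x) h - ‖h‖ ^ 2 ≤ ‖x + h - p (x + h)‖ ^ 2 := by
      have h1 := hp.norm_sub_le (x + h) x
      rw [add_sub_cancel_left] at h1
      have h2 := hp.norm_sub_le_of_mem x (hp.mem (x + h))
      have h3 : ‖x - p x‖ ^ 2 ≤ ‖x - p (x + h)‖ ^ 2 := by gcongr
      have e : ‖x + h - p (x + h)‖ ^ 2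
          = ‖x - p (x + h)‖ ^ 2 + 2 * inner ℝ (x - p (x + h)) h + ‖h‖ ^ 2 := by
        rw [← norm_add_sq_real]; congr 2; abel
      have e2 : inner ℝ (x - p (x + h)) h = inner ℝ (x - p x) h - inner ℝ (p (x + h) - p x) h := by
        rw [← inner_sub_left]; congr 1; abel
      have h4 := real_inner_le_norm (p (x + h) - p x) h
      nlinarith [norm_nonneg h]
    rw [Real.norm_eq_abs, abs_le, innerSL_apply_apply, real_inner_smul_left]
    simp only [norm_pow, norm_norm, one_mul]
    constructor <;> linarith
  refine (Asymptotics.IsBigO.of_bound 1 (Eventually.of_forall hb)).trans_isLittleO ?_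
  have := (Asymptotics.isLittleO_norm_pow_id (E' := E) (n := 2) (by norm_num))
  exact this

end IsProj

variable [FiniteDimensional ℝ E] [MeasurableSpace E] [BorelSpace E]

/-- These functions smooth the indicator of `K`; for positive `n` the gradient is a nonpositive
multiple of the outward normal `x - p x`. -/
theorem IsProj.hasFDerivAt_exp {K : Set E} {p : E → E} (hp : IsProj K p) (n : ℝ) (x : E) :
    HasFDerivAt (fun x => Real.exp (-n * ‖x - p x‖ ^ 2))
      (innerSL ℝ ((-2 * n * Real.exp (-n * ‖x - p x‖ ^ 2)) • (x - p x))) x := by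
  convert! ((hp.hasFDerivAt_sq x).const_mul (-n)).exp using 1
  ext y
  simp
  ring

theorem mul_exp_neg_mul_sq_le {n r : ℝ} (hn : 1 ≤ n) :
    2 * n * Real.exp (-n * r ^ 2) * r ≤ 2 * n := by
  have h1 : r ≤ Real.exp (n * r ^ 2) := by
    have := Real.add_one_le_exp (n * r ^ 2)
    nlinarith [sq_nonneg (r - 1)]
  have : Real.exp (-n * r ^ 2) * r ≤ 1 := by
    rw [neg_mul, Real.exp_neg, inv_mul_le_iff₀ (Real.exp_pos _), mul_one]
    exact h1
  nlinarith

/-- A reverse Gaussian correlation inequality for closed convex sets whose outward normals form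
obtuse angles. -/
theorem stdGaussian_inter_le {K L : Set E} {p q : E → E} (hK : IsClosed K) (hL : IsClosed L)
    (hp : IsProj K p) (hq : IsProj L q)
    (hpq : ∀ x y, inner ℝ (x - p x) (y - q y) ≤ 0) :
    (stdGaussian E) (K ∩ L) ≤ (stdGaussian E) K * (stdGaussian E) L := by
  have hcp := hp.continuous
  have hcq := hq.continuous
  have bound : ∀ n : ℕ, ∀ r : ℝ, |Real.exp (-((n : ℝ) + 1) * r ^ 2)| ≤ 1 := fun n r => by
    rw [abs_of_pos (Real.exp_pos _), Real.exp_le_one_iff, neg_mul, neg_nonpos]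
    positivity
  -- Both gradients carry a negative factor, so their inner product keeps the sign of that of the
  -- normals, given by `hpq`. The shift `n + 1` meets the condition `1 ≤ n` of the gradient bound.
  have key : ∀ n : ℕ,
      ∫ x, Real.exp (-((n : ℝ) + 1) * ‖x - p x‖ ^ 2) * Real.exp (-((n : ℝ) + 1) * ‖x - q x‖ ^ 2)
        ∂(stdGaussian E)
      ≤ (∫ x, Real.exp (-((n : ℝ) + 1) * ‖x - p x‖ ^ 2) ∂(stdGaussian E))
        * ∫ x, Real.exp (-((n : ℝ) + 1) * ‖x - q x‖ ^ 2) ∂(stdGaussian E) := by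
    intro n
    have gb : ∀ v : E, ‖(-2 * ((n : ℝ) + 1) * Real.exp (-((n : ℝ) + 1) * ‖v‖ ^ 2)) • v‖
        ≤ 2 * ((n : ℝ) + 1) := fun v => by
      rw [norm_smul, Real.norm_eq_abs, abs_mul, abs_of_pos (Real.exp_pos _), abs_mul, abs_neg,
        abs_of_pos (by positivity : (0 : ℝ) < n + 1), abs_of_pos (two_pos : (0 : ℝ) < 2)]
      exact mul_exp_neg_mul_sq_le (by simp)
    have one_le : (1 : ℝ) ≤ 2 * ((n : ℝ) + 1) := by
      have : (0 : ℝ) ≤ n := n.cast_nonneg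
      linarith
    refine integral_mul_le_of_inner_grad_nonpos (C := 2 * ((n : ℝ) + 1))
      (hp.hasFDerivAt_exp _) (hq.hasFDerivAt_exp _) (by fun_prop)
      (fun x => (bound n _).trans one_le) (fun x => (bound n _).trans one_le)
      (fun x => gb _) (fun x => gb _) fun x y => ?_
    rw [real_inner_smul_left, real_inner_smul_right, ← mul_assoc]
    refine mul_nonpos_of_nonneg_of_nonpos ?_ (hpq x y)
    refine mul_nonneg_of_nonpos_of_nonpos ?_ ?_ <;>
    · refine mul_nonpos_of_nonpos_of_nonneg ?_ (Real.exp_pos _).le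
      have : (0 : ℝ) ≤ n := n.cast_nonneg
      linarith
  have pt : ∀ {A : Set E} {r : E → E}, IsProj A r → ∀ x,
      Tendsto (fun n : ℕ => Real.exp (-((n : ℝ) + 1) * ‖x - r x‖ ^ 2)) atTop
        (𝓝 (A.indicator 1 x)) := by
    intro A r hr x
    by_cases hx : x ∈ A
    · simp [hr.eq_self_of_mem hx, hx]
    · rw [indicator_of_notMem hx]
      have hpos : 0 < ‖x - r x‖ ^ 2 := by
        have : x - r x ≠ 0 := fun h => hx (by rw [sub_eq_zero.1 h]; exact hr.mem x)
        positivity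
      refine Real.tendsto_exp_atBot.comp ?_
      refine Tendsto.atBot_mul_const hpos (tendsto_neg_atTop_atBot.comp ?_)
      exact tendsto_atTop_add_const_right _ _ tendsto_natCast_atTop_atTop
  have lim : ∀ {A : Set E} {r : E → E}, IsClosed A → IsProj A r →
      Tendsto (fun n : ℕ => ∫ x, Real.exp (-((n : ℝ) + 1) * ‖x - r x‖ ^ 2) ∂(stdGaussian E)) atTop
        (𝓝 ((stdGaussian E).real A)) := by
    intro A r hA hr
    have hcr := hr.continuous
    rw [← integral_indicator_one hA.measurableSet]
    exact tendsto_integral_of_dominated_convergence (fun _ => 1)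
      (fun n => Continuous.aestronglyMeasurable (by fun_prop)) (integrable_const _)
      (fun n => ae_of_all _ fun x => bound n _) (ae_of_all _ (pt hr))
  have lim2 : Tendsto (fun n : ℕ => ∫ x, Real.exp (-((n : ℝ) + 1) * ‖x - p x‖ ^ 2)
        * Real.exp (-((n : ℝ) + 1) * ‖x - q x‖ ^ 2) ∂(stdGaussian E)) atTop
        (𝓝 ((stdGaussian E).real (K ∩ L))) := by
    rw [← integral_indicator_one (hK.inter hL).measurableSet]
    refine tendsto_integral_of_dominated_convergence (fun _ => 1)
      (fun n => Continuous.aestronglyMeasurable (by fun_prop)) (integrable_const _)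
      (fun n => ae_of_all _ fun x => ?_) (ae_of_all _ fun x => ?_)
    · rw [norm_mul]
      exact mul_le_one₀ (bound n _) (norm_nonneg _) (bound n _)
    · rw [inter_indicator_one]
      exact (pt hp x).mul (pt hq x)
  have := le_of_tendsto_of_tendsto' lim2 ((lim hK hp).mul (lim hL hq)) key
  rw [measureReal_def, measureReal_def, measureReal_def, ← ENNReal.toReal_mul] at this
  exact (ENNReal.toReal_le_toReal (measure_ne_top _ _)
    (ENNReal.mul_ne_top (measure_ne_top _ _) (measure_ne_top _ _))).1 this

end Convex

/-! ### Projection onto the cone, and the law of its squared norm. -/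

section Cone

variable {d : ℕ} (T : ProperCone ℝ (EuclideanSpace ℝ (Fin d)))

theorem cone_add_mem {x y : EuclideanSpace ℝ (Fin d)} (hx : x ∈ T) (hy : y ∈ T) : x + y ∈ T :=
  add_mem hx hy

theorem cone_smul_mem {x : EuclideanSpace ℝ (Fin d)} (hx : x ∈ T) {c : ℝ} (hc : 0 ≤ c) :
    c • x ∈ T :=
  T.toPointedCone.smul_mem hc hx

theorem cone_convex : Convex ℝ (T : Set (EuclideanSpace ℝ (Fin d))) :=
  fun _ hx _ hy _ _ ha hb _ => cone_add_mem T (cone_smul_mem T hx ha) (cone_smul_mem T hy hb)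

theorem isClosed_cone : IsClosed (T : Set (EuclideanSpace ℝ (Fin d))) := T.isClosed

/-- A nearest point exists, so the default value in `metricProj` is never taken, and a nearest point
satisfies the variational inequality. -/
theorem isProj_metricProj : IsProj (T : Set (EuclideanSpace ℝ (Fin d))) (metricProj T) := by
  obtain ⟨p, hp⟩ := exists_isProj (K := (T : Set (EuclideanSpace ℝ (Fin d)))) ⟨0, zero_mem T⟩
    (isClosed_cone T) (cone_convex T)
  have h : ∀ v, metricProj (T : Set (EuclideanSpace ℝ (Fin d))) v ∈ T ∧
      ∀ s ∈ (T : Set (EuclideanSpace ℝ (Fin d))), ‖v - metricProj T v‖ ≤ ‖v - s‖ := by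
    intro v
    have hex : ∃ t ∈ (T : Set (EuclideanSpace ℝ (Fin d))), ∀ s ∈ (T : Set _), ‖v - t‖ ≤ ‖v - s‖ :=
      ⟨p v, hp.mem v, fun s hs => hp.norm_sub_le_of_mem v hs⟩
    rw [metricProj, dif_pos hex]
    exact hex.choose_spec
  refine ⟨fun x => (h x).1, fun x => ?_⟩
  rw [← norm_eq_iInf_iff_real_inner_le_zero (cone_convex T) (h x).1]
  have : Nonempty (T : Set (EuclideanSpace ℝ (Fin d))) := ⟨⟨0, zero_mem T⟩⟩
  exact le_antisymm (le_ciInf fun w => (h x).2 w w.2)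
    (ciInf_le (f := fun w : (T : Set (EuclideanSpace ℝ (Fin d))) => ‖x - w‖)
      ⟨0, forall_mem_range.2 fun _ => norm_nonneg _⟩ ⟨_, (h x).1⟩)

theorem inner_sub_metricProj_le (v : EuclideanSpace ℝ (Fin d)) {t : EuclideanSpace ℝ (Fin d)}
    (ht : t ∈ T) : inner ℝ (v - metricProj T v) t ≤ 0 := by
  have := (isProj_metricProj T).inner_le v (metricProj T v + t)
    (cone_add_mem T ((isProj_metricProj T).mem v) ht)
  simpa using this

theorem inner_sub_metricProj_self (v : EuclideanSpace ℝ (Fin d)) :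
    inner ℝ (v - metricProj T v) (metricProj T v) = 0 := by
  refine le_antisymm (inner_sub_metricProj_le T v ((isProj_metricProj T).mem v)) ?_
  have := (isProj_metricProj T).inner_le v 0 (zero_mem T)
  simpa using this

/-- By Moreau's decomposition `v - 𝐓v` is orthogonal to `𝐓v` and polar to `T`, so `t = 𝐓v` is the
critical test vector. This presents `{‖𝐓v‖ ≤ a}` as an intersection of half-spaces, which gives its
convexity and its normals. -/
theorem norm_metricProj_le_iff {a : ℝ} (ha : 0 ≤ a) (v : EuclideanSpace ℝ (Fin d)) :
    ‖metricProj T v‖ ≤ a ↔ ∀ t ∈ T, inner ℝ v t ≤ a * ‖t‖ := by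
  constructor
  · intro h t ht
    have h1 := inner_sub_metricProj_le T v ht
    rw [inner_sub_left] at h1
    have h2 := real_inner_le_norm (metricProj T v) t
    have h3 : ‖metricProj T v‖ * ‖t‖ ≤ a * ‖t‖ := by gcongr
    linarith
  · intro h
    have h1 := h _ ((isProj_metricProj T).mem v)
    have h2 := inner_sub_metricProj_self T v
    rw [inner_sub_left, real_inner_self_eq_norm_sq] at h2
    by_contra! hlt
    nlinarith

theorem norm_metricProj_le (v : EuclideanSpace ℝ (Fin d)) : ‖metricProj T v‖ ≤ ‖v‖ :=
  (norm_metricProj_le_iff T (norm_nonneg v) v).2 fun t _ => real_inner_le_norm v t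

theorem continuous_metricProj :
    Continuous (metricProj (T : Set (EuclideanSpace ℝ (Fin d)))) :=
  (isProj_metricProj T).continuous

theorem convex_norm_metricProj_le {a : ℝ} (ha : 0 ≤ a) :
    Convex ℝ {v : EuclideanSpace ℝ (Fin d) | ‖metricProj T v‖ ≤ a} := by
  intro x hx y hy r s hr hs hrs
  rw [mem_ofPred_eq, norm_metricProj_le_iff T ha] at *
  intro t ht
  rw [inner_add_left, real_inner_smul_left, real_inner_smul_left]
  have h1 := mul_le_mul_of_nonneg_left (hx t ht) hr
  have h2 := mul_le_mul_of_nonneg_left (hy t ht) hs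
  calc _ ≤ (r + s) * (a * ‖t‖) := by linarith
    _ = _ := by rw [hrs, one_mul]

theorem convex_preimage_add_cone (v : EuclideanSpace ℝ (Fin d)) :
    Convex ℝ {z | z + v ∈ T} := by
  simpa [add_comm] using! (cone_convex T).translate_preimage_left v

/-- The bipolar theorem. -/
theorem mem_cone_of_forall_inner_nonneg {x : EuclideanSpace ℝ (Fin d)}
    (h : ∀ w : EuclideanSpace ℝ (Fin d), (∀ t ∈ T, 0 ≤ inner ℝ t w) → 0 ≤ inner ℝ x w) : x ∈ T := by
  rw [← ProperCone.innerDual_innerDual T, ProperCone.mem_innerDual]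
  intro w hw
  rw [real_inner_comm]
  exact h w fun t ht => hw ht

theorem isClosed_preimage_add_cone (v : EuclideanSpace ℝ (Fin d)) :
    IsClosed {z : EuclideanSpace ℝ (Fin d) | z + v ∈ T} :=
  (isClosed_cone T).preimage (continuous_id.add continuous_const)

theorem isClosed_norm_metricProj_le (a : ℝ) :
    IsClosed {v : EuclideanSpace ℝ (Fin d) | ‖metricProj T v‖ ≤ a} :=
  isClosed_le (continuous_metricProj T).norm continuous_const

/-- The set `T - v` is stable under adding elements of `T`, so its outward normals lie in the polar
cone. -/
theorem inner_sub_proj_translate_le {v : EuclideanSpace ℝ (Fin d)}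
    {p : EuclideanSpace ℝ (Fin d) → EuclideanSpace ℝ (Fin d)}
    (hp : IsProj {z : EuclideanSpace ℝ (Fin d) | z + v ∈ T} p) (x : EuclideanSpace ℝ (Fin d))
    {t : EuclideanSpace ℝ (Fin d)} (ht : t ∈ T) : inner ℝ (x - p x) t ≤ 0 := by
  have hm : p x + v ∈ T := hp.mem x
  have hm' : p x + t + v ∈ T := by
    rw [add_right_comm]
    exact cone_add_mem T hm ht
  have := hp.inner_le x (p x + t) hm'
  rwa [add_sub_cancel_left] at this

/-- Subtracting an element `w` of the dual cone preserves all the half-space constraints, so an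
outward normal pairs nonnegatively with every such `w` and lies in the bidual `T`. -/
theorem sub_proj_norm_metricProj_mem {a : ℝ} (ha : 0 ≤ a)
    {q : EuclideanSpace ℝ (Fin d) → EuclideanSpace ℝ (Fin d)}
    (hq : IsProj {v : EuclideanSpace ℝ (Fin d) | ‖metricProj T v‖ ≤ a} q)
    (y : EuclideanSpace ℝ (Fin d)) : y - q y ∈ T := by
  refine mem_cone_of_forall_inner_nonneg T fun w hw => ?_
  have hqy : ‖metricProj T (q y)‖ ≤ a := hq.mem y
  have hm : ‖metricProj T (q y - w)‖ ≤ a := by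
    rw [norm_metricProj_le_iff T ha] at hqy ⊢
    intro t ht
    have h2 := hqy t ht
    have h3 := hw t ht
    rw [inner_sub_left, real_inner_comm t w]
    linarith
  have h1 := hq.inner_le y (q y - w) hm
  rw [sub_sub_cancel_left, inner_neg_right] at h1
  linarith

/-- The squared norm of a standard Gaussian vector conditioned on a translate `T - v`, `v ∈ T`,
of the cone stochastically dominates the squared norm of its projection onto the cone. -/
theorem stdGaussian_translate_cone_le {v : EuclideanSpace ℝ (Fin d)} (hv : v ∈ T) {c : ℝ}
    (hc : 0 ≤ c) :
    (stdGaussian (EuclideanSpace ℝ (Fin d))) {z | z + v ∈ T ∧ ‖z‖ ^ 2 ≤ c}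
      ≤ (stdGaussian (EuclideanSpace ℝ (Fin d))) {z | z + v ∈ T}
        * ENNReal.ofReal (coneCdf (T : Set (EuclideanSpace ℝ (Fin d))) c) := by
  have hset : {z : EuclideanSpace ℝ (Fin d) | ‖metricProj T z‖ ^ 2 ≤ c}
      = {z | ‖metricProj T z‖ ≤ √c} := by
    ext z
    exact (Real.le_sqrt (norm_nonneg _) hc).symm
  have hKcl := isClosed_preimage_add_cone T v
  have hLcl := isClosed_norm_metricProj_le T (√c)
  have h0 : (0 : EuclideanSpace ℝ (Fin d)) ∈ {z : EuclideanSpace ℝ (Fin d) | z + v ∈ T} := by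
    rw [mem_ofPred_eq, zero_add]
    exact hv
  have h0' : (0 : EuclideanSpace ℝ (Fin d))
      ∈ {z : EuclideanSpace ℝ (Fin d) | ‖metricProj T z‖ ≤ √c} :=
    (norm_metricProj_le T 0).trans (by simp)
  obtain ⟨p, hp⟩ := exists_isProj ⟨0, h0⟩ hKcl (convex_preimage_add_cone T v)
  obtain ⟨q, hq⟩ := exists_isProj ⟨0, h0'⟩ hLcl (convex_norm_metricProj_le T (Real.sqrt_nonneg c))
  have key := stdGaussian_inter_le hKcl hLcl hp hq fun x y =>
    inner_sub_proj_translate_le T hp x (sub_proj_norm_metricProj_mem T (Real.sqrt_nonneg c) hq y)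
  rw [coneCdf, hset, measureReal_def, ENNReal.ofReal_toReal (measure_ne_top _ _)]
  refine (measure_mono ?_).trans key
  rintro z ⟨h1, h2⟩
  exact ⟨h1, (norm_metricProj_le T z).trans (Real.le_sqrt_of_sq_le h2)⟩

/-! ### The distribution function of the squared norm of the projection -/

theorem coneCdf_mono : Monotone (coneCdf (T : Set (EuclideanSpace ℝ (Fin d)))) :=
  fun _ _ hab => measureReal_mono fun _ hv => le_trans hv hab

theorem coneCdf_of_neg {c : ℝ} (hc : c < 0) :
    coneCdf (T : Set (EuclideanSpace ℝ (Fin d))) c = 0 := by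
  have : {v : EuclideanSpace ℝ (Fin d) | ‖metricProj T v‖ ^ 2 ≤ c} = ∅ := by
    ext v
    simpa using hc.trans_le (by positivity)
  simp [coneCdf, this]

theorem coneCdf_nonneg (c : ℝ) : 0 ≤ coneCdf (T : Set (EuclideanSpace ℝ (Fin d))) c :=
  measureReal_nonneg

variable {α : ℝ}

theorem coneCdf_lt_of_lt_quantile (hα : 0 < α) {c : ℝ}
    (hc : c < cdfQuantile (coneCdf (T : Set (EuclideanSpace ℝ (Fin d)))) α) :
    coneCdf (T : Set (EuclideanSpace ℝ (Fin d))) c < α := by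
  by_contra! h
  -- Needed because a real `sInf` of a set unbounded below is `0`; `α > 0` excludes negative points.
  have hbdd : BddBelow {c | α ≤ coneCdf (T : Set (EuclideanSpace ℝ (Fin d))) c} := by
    refine ⟨0, fun z hz => ?_⟩
    by_contra! hz0
    rw [mem_ofPred_eq, coneCdf_of_neg T hz0] at hz
    exact absurd hz (not_le.2 hα)
  exact absurd (csInf_le hbdd h) (not_le.2 hc)

theorem tendsto_coneCdf_atTop :
    Tendsto (coneCdf (T : Set (EuclideanSpace ℝ (Fin d)))) atTop (𝓝 1) := by
  have h : Tendsto (fun c : ℝ => (stdGaussian (EuclideanSpace ℝ (Fin d)))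
      {v | ‖metricProj T v‖ ^ 2 ≤ c}) atTop
      (𝓝 ((stdGaussian (EuclideanSpace ℝ (Fin d))) (⋃ c : ℝ, {v | ‖metricProj T v‖ ^ 2 ≤ c}))) :=
    tendsto_measure_iUnion_atTop fun a b hab v hv => le_trans hv hab
  have hu : (⋃ c : ℝ, {v : EuclideanSpace ℝ (Fin d) | ‖metricProj T v‖ ^ 2 ≤ c}) = univ :=
    eq_univ_of_forall fun v => mem_iUnion.2 ⟨_, le_refl (‖metricProj T v‖ ^ 2)⟩
  rw [hu, measure_univ] at h
  exact (ENNReal.tendsto_toReal ENNReal.one_ne_top).comp h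

theorem le_coneCdf_of_quantile_lt (hα : α < 1) {c : ℝ}
    (hc : cdfQuantile (coneCdf (T : Set (EuclideanSpace ℝ (Fin d)))) α < c) :
    α ≤ coneCdf (T : Set (EuclideanSpace ℝ (Fin d))) c := by
  have hne : {c | α ≤ coneCdf (T : Set (EuclideanSpace ℝ (Fin d))) c}.Nonempty :=
    (((tendsto_coneCdf_atTop T).eventually (lt_mem_nhds hα)).mono fun _ h => h.le).exists
  obtain ⟨z, hz, hzc⟩ := exists_lt_of_csInf_lt hne hc
  exact le_trans hz (coneCdf_mono T hzc.le)

/-- The function is below `α` to the left of the quantile and at least `α` to the right; continuity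
closes the gap. -/
theorem coneCdf_quantile (hα : α ∈ Ioo (0 : ℝ) 1)
    (hcont : ContinuousAt (coneCdf (T : Set (EuclideanSpace ℝ (Fin d))))
      (cdfQuantile (coneCdf (T : Set (EuclideanSpace ℝ (Fin d)))) α)) :
    coneCdf (T : Set (EuclideanSpace ℝ (Fin d)))
      (cdfQuantile (coneCdf (T : Set (EuclideanSpace ℝ (Fin d)))) α) = α := by
  refine le_antisymm ?_ ?_
  · exact le_of_tendsto (hcont.tendsto.mono_left nhdsWithin_le_nhds)
      (eventually_nhdsWithin_of_forall (s := Iio _) fun c (hc : c < _) =>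
        (coneCdf_lt_of_lt_quantile T hα.1 hc).le)
  · exact ge_of_tendsto (hcont.tendsto.mono_left nhdsWithin_le_nhds)
      (eventually_nhdsWithin_of_forall (s := Ioi _) fun c (hc : _ < c) => le_coneCdf_of_quantile_lt T hα.2 hc)

/-- At a nonpositive quantile the left limit would be `0`, not `α`. Positivity leaves room for the
nonnegative levels that `stdGaussian_translate_cone_le` requires. -/
theorem quantile_pos (hα : α ∈ Ioo (0 : ℝ) 1)
    (hcont : ContinuousAt (coneCdf (T : Set (EuclideanSpace ℝ (Fin d))))
      (cdfQuantile (coneCdf (T : Set (EuclideanSpace ℝ (Fin d)))) α)) :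
    0 < cdfQuantile (coneCdf (T : Set (EuclideanSpace ℝ (Fin d)))) α := by
  by_contra! h
  have : coneCdf (T : Set (EuclideanSpace ℝ (Fin d)))
      (cdfQuantile (coneCdf (T : Set (EuclideanSpace ℝ (Fin d)))) α) ≤ 0 :=
    le_of_tendsto (hcont.tendsto.mono_left nhdsWithin_le_nhds)
      (eventually_nhdsWithin_of_forall (s := Iio _) fun c (hc : c < _) =>
        (coneCdf_of_neg T (hc.trans_le h)).le)
  rw [coneCdf_quantile T hα hcont] at this
  exact absurd hα.1 (not_lt.2 this)

theorem metricProj_of_eq_univ (hT : (T : Set (EuclideanSpace ℝ (Fin d))) = univ)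
    (v : EuclideanSpace ℝ (Fin d)) : metricProj T v = v :=
  (isProj_metricProj T).eq_self_of_mem (hT ▸ mem_univ v)

/-- If the cone is the whole space, the distribution function is strictly increasing. -/
theorem coneCdf_lt_of_lt (hd : 1 ≤ d) (hT : (T : Set (EuclideanSpace ℝ (Fin d))) = univ)
    {a b : ℝ} (ha : 0 ≤ a) (hab : a < b) :
    coneCdf (T : Set (EuclideanSpace ℝ (Fin d))) a
      < coneCdf (T : Set (EuclideanSpace ℝ (Fin d))) b := by
  have : Nontrivial (EuclideanSpace ℝ (Fin d)) := by
    have : Nonempty (Fin d) := ⟨⟨0, hd⟩⟩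
    infer_instance
  set γ := stdGaussian (EuclideanSpace ℝ (Fin d))
  set U : Set (EuclideanSpace ℝ (Fin d)) := {v | a < ‖v‖ ^ 2 ∧ ‖v‖ ^ 2 < b}
  have hUo : IsOpen U := by
    have hc : Continuous fun v : EuclideanSpace ℝ (Fin d) => ‖v‖ ^ 2 := by fun_prop
    exact (isOpen_lt continuous_const hc).inter (isOpen_lt hc continuous_const)
  -- The spherical shell is nonempty because `d ≥ 1`.
  have hUne : U.Nonempty := by
    obtain ⟨v, hv⟩ := exists_norm_eq (EuclideanSpace ℝ (Fin d)) (Real.sqrt_nonneg ((a + b) / 2))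
    refine ⟨v, ?_⟩
    simp only [U, mem_ofPred_eq, hv, Real.sq_sqrt (by linarith : 0 ≤ (a + b) / 2)]
    constructor <;> linarith
  have hUpos : 0 < γ U := by
    rw [pos_iff_ne_zero]
    intro h0
    have hc := continuous_gaussDensity (E := EuclideanSpace ℝ (Fin d))
    rw [show γ = _ from stdGaussian_eq_withDensity,
      withDensity_apply_eq_zero (by fun_prop)] at h0
    have : {x : EuclideanSpace ℝ (Fin d) | ENNReal.ofReal (gaussDensity x) ≠ 0} ∩ U = U := by
      rw [inter_eq_right]
      intro x _
      simpa using gaussDensity_pos x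
    rw [this] at h0
    exact (hUo.measure_pos volume hUne).ne' h0
  have hdisj : Disjoint {v : EuclideanSpace ℝ (Fin d) | ‖v‖ ^ 2 ≤ a} U :=
    disjoint_left.2 fun v hv hv' => absurd hv (not_le.2 hv'.1)
  simp only [coneCdf, metricProj_of_eq_univ T hT]
  calc γ.real {v | ‖v‖ ^ 2 ≤ a} < γ.real {v | ‖v‖ ^ 2 ≤ a} + γ.real U :=
        lt_add_of_pos_right _ (ENNReal.toReal_pos hUpos.ne' (measure_ne_top _ _))
    _ = γ.real ({v | ‖v‖ ^ 2 ≤ a} ∪ U) := (measureReal_union hdisj hUo.measurableSet).symm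
    _ ≤ _ := measureReal_mono (by
      rintro v (hv | hv)
      · exact le_trans hv hab.le
      · exact hv.2.le)

end Cone

/-! ### Shifted Gaussian mass and exhaustion of the cone by convex sets. -/

section LocalMass

variable {E : Type*} [NormedAddCommGroup E] [InnerProductSpace ℝ E] [FiniteDimensional ℝ E]
  [MeasurableSpace E] [BorelSpace E]

/-- The density of `N(v, I)` at `y`. -/
noncomputable def shiftDensity (v y : E) : ℝ≥0∞ := ENNReal.ofReal (gaussDensity (y - v))

theorem measurable_shiftDensity (v : E) : Measurable (shiftDensity v) := by
  have := continuous_gaussDensity (E := E)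
  unfold shiftDensity
  fun_prop

theorem shiftDensity_ne_zero (v y : E) : shiftDensity v y ≠ 0 := by
  simpa [shiftDensity] using gaussDensity_pos (y - v)

/-- The mass that `N(v, I)` puts on `S`. -/
noncomputable def shiftMass (v : E) (S : Set E) : ℝ≥0∞ := ∫⁻ y in S, shiftDensity v y

theorem shiftMass_eq (v : E) {S : Set E} (hS : MeasurableSet S) :
    shiftMass v S = (stdGaussian E) {z | z + v ∈ S} := by
  have hS' : MeasurableSet {z | z + v ∈ S} := hS.preimage (measurable_add_const v)
  rw [stdGaussian_eq_withDensity, withDensity_apply _ hS', shiftMass, ← lintegral_indicator hS,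
    ← lintegral_indicator hS', ← lintegral_add_right_eq_self _ v]
  congr 1
  ext z
  by_cases h : z + v ∈ S
  · rw [indicator_of_mem h, indicator_of_mem (show z ∈ {z | z + v ∈ S} from h), shiftDensity,
      add_sub_cancel_right]
  · rw [indicator_of_notMem h, indicator_of_notMem (show z ∉ {z | z + v ∈ S} from h)]

theorem shiftMass_le_one (v : E) {S : Set E} (hS : MeasurableSet S) : shiftMass v S ≤ 1 := by
  rw [shiftMass_eq v hS]
  exact prob_le_one

theorem shiftMass_mono (v : E) {S S' : Set E} (h : S ⊆ S') : shiftMass v S ≤ shiftMass v S' :=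
  lintegral_mono_set h

/-- A finite measure that dominates all `N(v, I)` with `v` in a bounded set. -/
noncomputable def wideMeasure (E : Type*) [NormedAddCommGroup E] [InnerProductSpace ℝ E]
    [FiniteDimensional ℝ E] [MeasurableSpace E] [BorelSpace E] : Measure E :=
  volume.withDensity fun y => ENNReal.ofReal (Real.exp (-(1 / 4) * ‖y‖ ^ 2))

instance : IsFiniteMeasure (wideMeasure E) :=
  isFiniteMeasure_withDensity_ofReal (integrable_exp_neg_mul_sq_norm (by norm_num)).2

/-- From `‖y‖² ≤ 2‖y - v‖² + 2‖v‖²` one gets `-½‖y - v‖² ≤ ½M² - ¼‖y‖²`. One finite measure thus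
controls all bounded centres at once. -/
theorem shiftMass_le_wideMeasure {v : E} {M : ℝ} (hv : ‖v‖ ≤ M) {S : Set E}
    (hS : MeasurableSet S) :
    shiftMass v S ≤ ENNReal.ofReal (gaussConst E * Real.exp (M ^ 2 / 2)) * wideMeasure E S := by
  rw [wideMeasure, withDensity_apply _ hS, shiftMass, ← lintegral_const_mul _ (by fun_prop)]
  refine lintegral_mono fun y => ?_
  rw [shiftDensity, ← ENNReal.ofReal_mul (by have := gaussConst_pos E; positivity), gaussDensity,
    mul_assoc, ← Real.exp_add]
  refine ENNReal.ofReal_le_ofReal (mul_le_mul_of_nonneg_left (Real.exp_le_exp.2 ?_)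
    (gaussConst_pos E).le)
  have h1 : ‖y‖ ≤ ‖y - v‖ + ‖v‖ := by simpa using norm_add_le (y - v) v
  have h2 : ‖v‖ ^ 2 ≤ M ^ 2 := by gcongr
  have h3 : ‖y‖ ^ 2 ≤ (‖y - v‖ + ‖v‖) ^ 2 := by gcongr
  nlinarith [sq_nonneg (‖y - v‖ - ‖v‖)]

/-- The interiors of an increasing sequence of convex sets exhaust the closure of their union up
to a null set. -/
theorem volume_closure_sdiff_iUnion_interior {A : ℕ → Set E} (hA : ∀ n, Convex ℝ (A n))
    (hmono : Monotone A) : volume (closure (⋃ n, A n) \ ⋃ n, interior (A n)) = 0 := by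
  have hU : Convex ℝ (⋃ n, A n) := hmono.directed_le.convex_iUnion hA
  -- Frontiers of convex sets are Lebesgue null, both for the union and for each member.
  have h1 : closure (⋃ n, A n) \ ⋃ n, interior (A n)
      ⊆ frontier (⋃ n, A n) ∪ ⋃ n, frontier (A n) := by
    rintro x ⟨hx, hx'⟩
    by_cases hxU : x ∈ ⋃ n, A n
    · obtain ⟨n, hn⟩ := mem_iUnion.1 hxU
      exact Or.inr (mem_iUnion.2 ⟨n, subset_closure hn, fun h => hx' (mem_iUnion.2 ⟨n, h⟩)⟩)
    · exact Or.inl ⟨hx, fun h => hxU (interior_subset h)⟩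
  refine measure_mono_null h1 (measure_union_null (hU.addHaar_frontier _) ?_)
  exact measure_iUnion_null fun n => (hA n).addHaar_frontier _

/-- Continuity from above for a finite measure. Interiors are used because they are measurable
without assumptions on `A n`; the ball of fixed radius is what the saturation hypothesis on `Θosn`
later needs. -/
theorem exists_eventually_wideMeasure_sdiff_le {A : ℕ → Set E} {T : Set E} {N : ℕ}
    (hA : ∀ n ≥ N, Convex ℝ (A n)) (hmono : ∀ n ≥ N, ∀ n' ≥ n, A n ⊆ A n')
    (hT : T = closure (⋃ n ≥ N, A n)) {ε : ℝ≥0∞} (hε : ε ≠ 0) :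
    ∃ M : ℝ, ∀ᶠ n in atTop, wideMeasure E (T \ (interior (A n) ∩ Metric.closedBall 0 M)) ≤ ε := by
  have hTcl : IsClosed T := hT ▸ isClosed_closure
  set G : ℕ → Set E := fun m => interior (A (N + m)) ∩ Metric.closedBall 0 m with hG
  have hU : (⋃ n ≥ N, A n) = ⋃ m, A (N + m) := by
    ext x
    simp only [mem_iUnion]
    constructor
    · rintro ⟨n, hn, hx⟩
      exact ⟨n - N, by rwa [Nat.add_sub_cancel' hn]⟩
    · rintro ⟨m, hx⟩
      exact ⟨N + m, by simp, hx⟩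
  have hnull : volume (T \ ⋃ m, interior (A (N + m))) = 0 := by
    rw [hT, hU]
    exact volume_closure_sdiff_iUnion_interior (fun m => hA _ (by simp))
      fun m m' h => hmono _ (by simp) _ (by simpa using h)
  have hGmono : Monotone G := fun m m' h => inter_subset_inter
    (interior_mono (hmono _ (by simp) _ (by simpa using h)))
    (Metric.closedBall_subset_closedBall (by exact_mod_cast h))
  have hGmeas : ∀ m, MeasurableSet (G m) := fun m =>
    isOpen_interior.measurableSet.inter Metric.isClosed_closedBall.measurableSet
  have hlim : Tendsto (fun m => wideMeasure E (T \ G m)) atTop (𝓝 0) := by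
    have h := tendsto_measure_iInter_atTop (μ := wideMeasure E) (s := fun m => T \ G m)
      (fun m => (hTcl.measurableSet.diff (hGmeas m)).nullMeasurableSet)
      (fun m m' h => sdiff_subset_sdiff_right (hGmono h)) ⟨0, measure_ne_top _ _⟩
    have h0 : wideMeasure E (⋂ m, T \ G m) = 0 := by
      refine (withDensity_absolutelyContinuous _ _ : wideMeasure E ≪ volume)
        (measure_mono_null (fun x hx => ?_) hnull)
      rw [mem_iInter] at hx
      refine ⟨(hx 0).1, fun h => ?_⟩
      obtain ⟨m, hm⟩ := mem_iUnion.1 h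
      obtain ⟨m', hm'⟩ := exists_nat_ge ‖x‖
      refine (hx (max m m')).2 ⟨?_, ?_⟩
      · exact interior_mono (hmono _ (by simp) _ (by simp)) hm
      · rw [mem_closedBall_zero_iff]
        exact hm'.trans (by exact_mod_cast le_max_right m m')
    rwa [h0] at h
  obtain ⟨m, hm⟩ := (hlim.eventually (ge_mem_nhds (pos_iff_ne_zero.2 hε))).exists
  refine ⟨m, eventually_atTop.2 ⟨N + m, fun n hn => (measure_mono ?_).trans hm⟩⟩
  exact sdiff_subset_sdiff_right (inter_subset_inter_left _
    (interior_mono (hmono _ (by simp) _ hn)))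

end LocalMass

/-! ### Uniform comparison of Gaussian masses over bounded centres in the cone. -/

section Cone

variable {d : ℕ} (T : ProperCone ℝ (EuclideanSpace ℝ (Fin d)))

/-- For `v ∈ T` one has `T + v ⊆ T`, hence `T ⊆ T - v`. This bounds the mass of the cone below
uniformly in the centre. -/
theorem shiftMass_zero_le_shiftMass {v : EuclideanSpace ℝ (Fin d)} (hv : v ∈ T) :
    shiftMass 0 (T : Set (EuclideanSpace ℝ (Fin d))) ≤ shiftMass v (T : Set _) := by
  rw [shiftMass_eq _ (isClosed_cone T).measurableSet, shiftMass_eq _ (isClosed_cone T).measurableSet]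
  refine measure_mono fun z (hz : z + 0 ∈ T) => ?_
  rw [add_zero] at hz
  exact cone_add_mem T hz hv

/-- What the inner sets miss has small `wideMeasure`, hence at most the fraction `1 - ρ⁻¹` of the
mass of `T`, simultaneously for all `v`. -/
theorem exists_eventually_shiftMass_le {A : ℕ → Set (EuclideanSpace ℝ (Fin d))} {N : ℕ}
    (hA : ∀ n ≥ N, Convex ℝ (A n)) (hmono : ∀ n ≥ N, ∀ n' ≥ n, A n ⊆ A n')
    (hT : (T : Set (EuclideanSpace ℝ (Fin d))) = closure (⋃ n ≥ N, A n)) {ρ : ℝ} (hρ : 1 < ρ)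
    (M : ℝ) : ∃ M' : ℝ, ∀ᶠ n in atTop, ∀ v ∈ T, ‖v‖ ≤ M →
      shiftMass v (T : Set _)
        ≤ ENNReal.ofReal ρ * shiftMass v (interior (A n) ∩ Metric.closedBall 0 M') := by
  have hTm := (isClosed_cone T).measurableSet
  set κ := shiftMass 0 (T : Set (EuclideanSpace ℝ (Fin d)))
  set K := ENNReal.ofReal (gaussConst (EuclideanSpace ℝ (Fin d)) * Real.exp (M ^ 2 / 2))
  set τ := ENNReal.ofReal (1 - ρ⁻¹)
  have hτ : τ ≠ 0 := by
    simpa [τ] using inv_lt_one_of_one_lt₀ hρ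
  -- If the cone is Lebesgue null, the left side vanishes.
  by_cases hκ : κ = 0
  · refine ⟨0, Eventually.of_forall fun n v hv _ => ?_⟩
    have hvol : volume (T : Set (EuclideanSpace ℝ (Fin d))) = 0 := by
      have h0 : κ = 0 := hκ
      simp only [κ, shiftMass] at h0
      rw [lintegral_eq_zero_iff (measurable_shiftDensity _)] at h0
      have : ∀ᵐ y ∂(volume.restrict (T : Set (EuclideanSpace ℝ (Fin d)))), False :=
        h0.mono fun y hy => shiftDensity_ne_zero _ _ hy
      rwa [eventually_false_iff_eq_bot, ae_eq_bot, Measure.restrict_eq_zero] at this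
    have : shiftMass v (T : Set (EuclideanSpace ℝ (Fin d))) = 0 := setLIntegral_measure_zero _ _ hvol
    simp [this]
  · obtain ⟨M', hM'⟩ := exists_eventually_wideMeasure_sdiff_le hA hmono hT
      (ε := τ * κ / K) (ENNReal.div_ne_zero.2 ⟨mul_ne_zero hτ hκ, ENNReal.ofReal_ne_top⟩)
    refine ⟨M', hM'.mono fun n hn v hv hvM => ?_⟩
    set D := interior (A n) ∩ Metric.closedBall 0 M'
    have hDm : MeasurableSet D :=
      isOpen_interior.measurableSet.inter Metric.isClosed_closedBall.measurableSet
    have h1 : shiftMass v ((T : Set (EuclideanSpace ℝ (Fin d))) \ D) ≤ τ * shiftMass v (T : Set _) :=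
      calc _ ≤ K * wideMeasure _ ((T : Set (EuclideanSpace ℝ (Fin d))) \ D) :=
            shiftMass_le_wideMeasure hvM (hTm.diff hDm)
        _ ≤ K * (τ * κ / K) := by gcongr
        _ ≤ τ * κ := ENNReal.mul_div_le
        _ ≤ _ := by gcongr; exact shiftMass_zero_le_shiftMass T hv
    have h2 : shiftMass v (T : Set (EuclideanSpace ℝ (Fin d)))
        ≤ shiftMass v D + τ * shiftMass v (T : Set _) :=
      calc _ ≤ shiftMass v (D ∪ (T \ D)) := shiftMass_mono v (by simp)
        _ ≤ shiftMass v D + shiftMass v ((T : Set (EuclideanSpace ℝ (Fin d))) \ D) :=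
            lintegral_union_le _ _ _
        _ ≤ _ := by gcongr
    have hT1 := (shiftMass_le_one v hTm).trans_lt ENNReal.one_lt_top
    have hD1 := (shiftMass_le_one v hDm).trans_lt ENNReal.one_lt_top
    lift shiftMass v (T : Set (EuclideanSpace ℝ (Fin d))) to ℝ≥0 using hT1.ne with a
    lift shiftMass v D to ℝ≥0 using hD1.ne with b
    have hρ0 : 0 < ρ := by linarith
    have hρi : ρ⁻¹ < 1 := inv_lt_one_of_one_lt₀ hρ
    rw [← ENNReal.ofReal_coe_nnreal (p := a), ← ENNReal.ofReal_coe_nnreal (p := b)] at *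
    simp only [τ] at h2
    rw [← ENNReal.ofReal_mul (by linarith), ← ENNReal.ofReal_add (by positivity)
      (mul_nonneg (by linarith) (by positivity)), ENNReal.ofReal_le_ofReal_iff
      (add_nonneg (by positivity) (mul_nonneg (by linarith) (by positivity)))] at h2
    rw [← ENNReal.ofReal_mul (by linarith)]
    refine ENNReal.ofReal_le_ofReal ?_
    have h3 : ρ⁻¹ * (a : ℝ) ≤ b := by linarith
    rwa [inv_mul_le_iff₀ hρ0] at h3

end Cone

/-! ### Transport of prior integrals to Lebesgue integrals. -/

section Prior

variable {Θ : Type*} [MeasurableSpace Θ] {d : ℕ} {prior : Measure Θ} {ΘI ΘN : Set Θ}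
  {γ : Θ → EuclideanSpace ℝ (Fin d)} {Γ : Set (EuclideanSpace ℝ (Fin d))}

theorem lintegral_indicator_comp_of_density (hN : MeasurableSet ΘN)
    (hγ : Measurable (ΘN.domRestrict γ)) {B S : Set (EuclideanSpace ℝ (Fin d))}
    {π : EuclideanSpace ℝ (Fin d) → ℝ} (hB : MeasurableSet B) (hπ : ContinuousOn π B)
    (hdens : ((prior.restrict ΘN).map γ).restrict B =
      (volume.restrict B).withDensity fun x => ENNReal.ofReal (π x))
    (hS : MeasurableSet S) (hSB : S ⊆ B) {f : EuclideanSpace ℝ (Fin d) → ℝ≥0∞}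
    (hf : Measurable f) :
    ∫⁻ θ in ΘN, S.indicator f (γ θ) ∂prior = ∫⁻ x in S, ENNReal.ofReal (π x) * f x := by
  have hγ' : AEMeasurable γ (prior.restrict ΘN) := aemeasurable_restrict_of_measurable_subtype hN hγ
  have hπ' : AEMeasurable (fun x => ENNReal.ofReal (π x)) (volume.restrict B) :=
    (hπ.aemeasurable hB).ennreal_ofReal
  rw [← lintegral_map' (hf.indicator hS).aemeasurable hγ', lintegral_indicator hS,
    ← inter_eq_left.2 hSB, ← Measure.restrict_restrict hS, hdens, restrict_withDensity hS,
    Measure.restrict_restrict hS, inter_eq_left.2 hSB,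
    lintegral_withDensity_eq_lintegral_mul₀ (hπ'.mono_measure (Measure.restrict_mono hSB le_rfl))
      hf.aemeasurable]
  rfl

/-- The Jacobian `r⁻ᵈ` enters both the upper and the lower bound below and cancels in their ratio.
-/
theorem setLIntegral_comp_smul {r : ℝ} (hr : r ≠ 0) {S : Set (EuclideanSpace ℝ (Fin d))}
    (hS : MeasurableSet S) {f : EuclideanSpace ℝ (Fin d) → ℝ≥0∞} (hf : Measurable f) :
    ∫⁻ x in (fun x => r • x) ⁻¹' S, f (r • x)
      = ENNReal.ofReal |(r ^ d)⁻¹| * ∫⁻ y in S, f y := by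
  have hm : Measurable fun x : EuclideanSpace ℝ (Fin d) => r • x := measurable_const_smul r
  rw [← setLIntegral_map hS hf hm, Measure.map_addHaar_smul _ hr, Measure.restrict_smul,
    lintegral_smul_measure, finrank_euclideanSpace_fin, smul_eq_mul]

end Prior

/-! ### Comparison of local prior integrals with Gaussian masses on the cone. -/

section LocalBounds

variable {Θ : Type*} [MeasurableSpace Θ] {d : ℕ} {prior : Measure Θ} {ΘI ΘN A : Set Θ}
  {γ : Θ → EuclideanSpace ℝ (Fin d)} {Γ : Set (EuclideanSpace ℝ (Fin d))}
  {B S : Set (EuclideanSpace ℝ (Fin d))} {π : EuclideanSpace ℝ (Fin d) → ℝ} {a c s : ℝ}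

theorem setLIntegral_shiftDensity_le (hN : MeasurableSet ΘN)
    (hγ : Measurable (ΘN.domRestrict γ)) (hB : MeasurableSet B) (hπ : ContinuousOn π B)
    (hdens : ((prior.restrict ΘN).map γ).restrict B =
      (volume.restrict B).withDensity fun x => ENNReal.ofReal (π x))
    (hs : s ≠ 0) (hA : MeasurableSet A) (hAN : A ⊆ ΘN) (hAB : ∀ θ ∈ A, γ θ ∈ B)
    (hπa : ∀ x ∈ B, π x ≤ a) (hS : MeasurableSet S) (hAS : ∀ θ ∈ A, s • γ θ ∈ S)
    (v : EuclideanSpace ℝ (Fin d)) :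
    ∫⁻ θ in A, shiftDensity v (s • γ θ) ∂prior
      ≤ ENNReal.ofReal a * (ENNReal.ofReal |(s ^ d)⁻¹| * shiftMass v S) := by
  have hm : Measurable fun x : EuclideanSpace ℝ (Fin d) => s • x := measurable_const_smul s
  set S' := B ∩ (fun x => s • x) ⁻¹' S
  have hS' : MeasurableSet S' := hB.inter (hS.preimage hm)
  have hf : Measurable fun x => shiftDensity v (s • x) := (measurable_shiftDensity v).comp hm
  calc _ ≤ ∫⁻ θ in A, S'.indicator (fun x => shiftDensity v (s • x)) (γ θ) ∂prior :=
        setLIntegral_mono' hA fun θ hθ => by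
          rw [indicator_of_mem (show γ θ ∈ S' from ⟨hAB θ hθ, hAS θ hθ⟩)]
    _ ≤ ∫⁻ θ in ΘN, S'.indicator (fun x => shiftDensity v (s • x)) (γ θ) ∂prior :=
        lintegral_mono_set hAN
    _ = ∫⁻ x in S', ENNReal.ofReal (π x) * shiftDensity v (s • x) :=
        lintegral_indicator_comp_of_density hN hγ hB hπ hdens hS' inter_subset_left hf
    _ ≤ ∫⁻ x in S', ENNReal.ofReal a * shiftDensity v (s • x) :=
        setLIntegral_mono' hS' fun x hx => by
          gcongr
          exact hπa x hx.1
    _ = ENNReal.ofReal a * ∫⁻ x in S', shiftDensity v (s • x) := lintegral_const_mul _ hf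
    _ ≤ ENNReal.ofReal a * ∫⁻ x in (fun x => s • x) ⁻¹' S, shiftDensity v (s • x) := by
        gcongr
        exact inter_subset_right
    _ = _ := by rw [setLIntegral_comp_smul hs hS (measurable_shiftDensity v), shiftMass]

/-- The lower bound needs almost every `θ ∈ ΘN` with `s • γ θ ∈ S` to lie in `A`, since `γ` need not
be injective; the saturation hypothesis will supply this. -/
theorem mul_shiftMass_le_setLIntegral (hN : MeasurableSet ΘN)
    (hγ : Measurable (ΘN.domRestrict γ)) (hB : MeasurableSet B) (hπ : ContinuousOn π B)
    (hdens : ((prior.restrict ΘN).map γ).restrict B =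
      (volume.restrict B).withDensity fun x => ENNReal.ofReal (π x))
    (hs : s ≠ 0) (hA : MeasurableSet A) (hS : MeasurableSet S)
    (hSB : ∀ x, s • x ∈ S → x ∈ B) (hSA : ∀ᵐ θ ∂prior, θ ∈ ΘN → s • γ θ ∈ S → θ ∈ A)
    (hc : 0 ≤ c) (hπa : ∀ x ∈ B, a ≤ c * π x) (v : EuclideanSpace ℝ (Fin d)) :
    ENNReal.ofReal a * (ENNReal.ofReal |(s ^ d)⁻¹| * shiftMass v S)
      ≤ ENNReal.ofReal c * ∫⁻ θ in A, shiftDensity v (s • γ θ) ∂prior := by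
  have hm : Measurable fun x : EuclideanSpace ℝ (Fin d) => s • x := measurable_const_smul s
  set S' := (fun x : EuclideanSpace ℝ (Fin d) => s • x) ⁻¹' S
  have hS' : MeasurableSet S' := hS.preimage hm
  have hS'B : S' ⊆ B := fun x hx => hSB x hx
  have hf : Measurable fun x => shiftDensity v (s • x) := (measurable_shiftDensity v).comp hm
  calc _ = ENNReal.ofReal a * ∫⁻ x in S', shiftDensity v (s • x) := by
        rw [setLIntegral_comp_smul hs hS (measurable_shiftDensity v), shiftMass]
    _ = ∫⁻ x in S', ENNReal.ofReal a * shiftDensity v (s • x) := (lintegral_const_mul _ hf).symm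
    _ ≤ ∫⁻ x in S', ENNReal.ofReal c * (ENNReal.ofReal (π x) * shiftDensity v (s • x)) :=
        setLIntegral_mono' hS' fun x hx => by
          rw [← mul_assoc, ← ENNReal.ofReal_mul hc]
          gcongr
          exact hπa x (hS'B hx)
    _ = ENNReal.ofReal c * ∫⁻ x in S', ENNReal.ofReal (π x) * shiftDensity v (s • x) :=
        lintegral_const_mul' _ _ ENNReal.ofReal_ne_top
    _ = ENNReal.ofReal c
          * ∫⁻ θ in ΘN, S'.indicator (fun x => shiftDensity v (s • x)) (γ θ) ∂prior := by
        rw [lintegral_indicator_comp_of_density hN hγ hB hπ hdens hS' hS'B hf]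
    _ ≤ _ := by
        gcongr ENNReal.ofReal c * ?_
        rw [← lintegral_indicator hN, ← lintegral_indicator hA]
        refine lintegral_mono_ae (hSA.mono fun θ hθ => ?_)
        by_cases h1 : θ ∈ ΘN
        · rw [indicator_of_mem h1]
          by_cases h2 : γ θ ∈ S'
          · rw [indicator_of_mem h2, indicator_of_mem (hθ h1 h2)]
          · rw [indicator_of_notMem h2]
            exact zero_le
        · rw [indicator_of_notMem h1]
          exact zero_le

/-- Continuity and positivity at `0` make the prior density constant near `0` up to the factor `ρ`;
the value `π 0` then cancels. -/
theorem exists_ball_density_ratio {δ ρ : ℝ} (hδ : 0 < δ) (hρ : 1 < ρ)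
    (h0 : (0 : EuclideanSpace ℝ (Fin d)) ∈ Γ)
    (hπ : ContinuousOn π (Metric.ball 0 δ ∩ Γ)) (hpos : ∀ x ∈ Metric.ball 0 δ ∩ Γ, 0 < π x) :
    ∃ r, 0 < r ∧ r ≤ δ ∧ ∀ x ∈ Metric.ball 0 r ∩ Γ, π x ≤ ρ * π 0 ∧ π 0 ≤ ρ * π x := by
  have hm : (0 : EuclideanSpace ℝ (Fin d)) ∈ Metric.ball 0 δ ∩ Γ := ⟨Metric.mem_ball_self hδ, h0⟩
  have hp := hpos 0 hm
  have h1 : ∀ᶠ y in 𝓝 (π 0), y < ρ * π 0 := gt_mem_nhds (by nlinarith)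
  have h2 : ∀ᶠ y in 𝓝 (π 0), π 0 < ρ * y := by
    have : Tendsto (fun y => ρ * y) (𝓝 (π 0)) (𝓝 (ρ * π 0)) := tendsto_const_nhds.mul tendsto_id
    exact this.eventually (lt_mem_nhds (by nlinarith))
  have h3 := (hπ 0 hm).eventually (h1.and h2)
  rw [eventually_nhdsWithin_iff, Metric.eventually_nhds_iff] at h3
  obtain ⟨ε, hε, h⟩ := h3
  refine ⟨min ε δ, lt_min hε hδ, min_le_right _ _, fun x hx => ?_⟩
  have hx' := Metric.mem_ball.1 hx.1
  have := h (hx'.trans_le (min_le_left _ _))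
    ⟨Metric.mem_ball.2 (hx'.trans_le (min_le_right _ _)), hx.2⟩
  exact ⟨this.1.le, this.2.le⟩

theorem IsLocalNhds.eventually_norm_lt {T : ProperCone ℝ (EuclideanSpace ℝ (Fin d))}
    {Θosn : ℕ → Set Θ} (hosn : IsLocalNhds prior ΘI ΘN γ T Θosn) {r : ℝ} (hr : 0 < r) :
    ∀ᶠ n in atTop, ∀ θ ∈ Θosn n, ‖γ θ‖ < r := by
  have h := hosn.tendsto_zero.eventually (gt_mem_nhds (ENNReal.ofReal_pos.2 hr))
  refine h.mono fun n hn θ hθ => ?_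
  have h1 : ‖γ θ‖ₑ ≤ ⨆ θ ∈ Θosn n, ‖γ θ‖ₑ := le_iSup₂ (f := fun θ _ => ‖γ θ‖ₑ) θ hθ
  have h2 := h1.trans_lt hn
  rwa [← ofReal_norm, ENNReal.ofReal_lt_ofReal_iff hr] at h2

/-- On compact sets of centres, the mass that the quadratic approximation of the quasi-posterior
gives to a subset of the local neighborhood is asymptotically bounded by the corresponding
Gaussian mass conditioned on the cone. -/
theorem eventually_setLIntegral_shiftDensity_le
    {T : ProperCone ℝ (EuclideanSpace ℝ (Fin d))} {Θosn : ℕ → Set Θ} (hI : ΘI.Nonempty)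
    (hγ : IsLocalReparam ΘI ΘN γ Γ) (hosn : IsLocalNhds prior ΘI ΘN γ T Θosn)
    (hdens : ∃ δ > 0, ∃ π : EuclideanSpace ℝ (Fin d) → ℝ,
      ContinuousOn π (Metric.ball 0 δ ∩ Γ) ∧ (∀ x ∈ Metric.ball 0 δ ∩ Γ, 0 < π x) ∧
      ((prior.restrict ΘN).map γ).restrict (Metric.ball 0 δ ∩ Γ) =
        (volume.restrict (Metric.ball 0 δ ∩ Γ)).withDensity fun x => ENNReal.ofReal (π x))
    {ρ : ℝ} (hρ : 1 < ρ) (M : ℝ) :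
    ∀ᶠ n : ℕ in atTop, ∀ v ∈ T, ‖v‖ ≤ M → ∀ A : Set Θ, MeasurableSet A →
      ∀ S : Set (EuclideanSpace ℝ (Fin d)), MeasurableSet S →
      (∀ θ ∈ A ∩ Θosn n, √(n : ℝ) • γ θ ∈ S) → ∀ F : ℝ≥0∞,
      shiftMass v S ≤ F * shiftMass v (T : Set _) →
      ∫⁻ θ in A ∩ Θosn n, shiftDensity v (√(n : ℝ) • γ θ) ∂prior
        ≤ ENNReal.ofReal (ρ ^ 3) * F * ∫⁻ θ in Θosn n, shiftDensity v (√(n : ℝ) • γ θ) ∂prior := by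
  obtain ⟨δ, hδ, π, hπ, hπpos, hd⟩ := hdens
  obtain ⟨θ₀, hθ₀⟩ := hI
  have h0Γ : (0 : EuclideanSpace ℝ (Fin d)) ∈ Γ := by
    have h1 := hγ.mapsTo (hγ.subset_nhd hθ₀)
    rwa [(hγ.eq_zero_iff θ₀ (hγ.subset_nhd hθ₀)).2 hθ₀] at h1
  obtain ⟨r, hr, hrδ, hratio⟩ := exists_ball_density_ratio hδ hρ h0Γ hπ hπpos
  have hsub : Metric.ball 0 r ∩ Γ ⊆ Metric.ball 0 δ ∩ Γ :=
    inter_subset_inter_left _ (Metric.ball_subset_ball hrδ)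
  have hBm : MeasurableSet (Metric.ball 0 r ∩ Γ) :=
    Metric.isOpen_ball.measurableSet.inter hγ.measurableSet_range
  have hd' : ((prior.restrict ΘN).map γ).restrict (Metric.ball 0 r ∩ Γ) =
      (volume.restrict (Metric.ball 0 r ∩ Γ)).withDensity fun x => ENNReal.ofReal (π x) := by
    have := congrArg (fun μ => μ.restrict (Metric.ball 0 r ∩ Γ)) hd
    simpa only [Measure.restrict_restrict hBm, inter_eq_left.2 hsub, restrict_withDensity hBm]
      using this
  obtain ⟨-, k, -, N, hcv, hmono, hTcl⟩ := hosn.covers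
  obtain ⟨M', hM'⟩ := exists_eventually_shiftMass_le T hcv hmono hTcl hρ M
  filter_upwards [hM', hosn.subset_nhd, hosn.eventually_norm_lt hr, hosn.saturated M',
    eventually_ge_atTop 1] with n hn hnN hnr hsat hn1 v hv hvM A hA S hS hAS F hF
  have hs : √(n : ℝ) ≠ 0 := by
    have : (0 : ℝ) < n := by exact_mod_cast hn1
    positivity
  have hom := hosn.measurableSet n hn1
  have hnB : ∀ θ ∈ Θosn n, γ θ ∈ Metric.ball 0 r ∩ Γ := fun θ hθ =>
    ⟨mem_ball_zero_iff.2 (hnr θ hθ), hγ.mapsTo (hnN hθ)⟩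
  set s := √(n : ℝ)
  -- A measurable bounded part of the rescaled neighbourhood that carries almost all the Gaussian
  -- mass of `T`.
  set D := interior ((fun θ => s • γ θ) '' Θosn n ∩ Metric.closedBall 0 (k n))
    ∩ Metric.closedBall 0 M'
  have hDm : MeasurableSet D :=
    isOpen_interior.measurableSet.inter Metric.isClosed_closedBall.measurableSet
  have hDex : ∀ x, s • x ∈ D → ∃ θ ∈ Θosn n, γ θ = x := fun x hx => by
    obtain ⟨θ, hθ, h⟩ := (interior_subset hx.1).1
    exact ⟨θ, hθ, smul_right_injective _ hs h⟩
  have hup := setLIntegral_shiftDensity_le hγ.measurableSet_nhd hγ.measurable hBm (hπ.mono hsub) hd'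
    hs (hA.inter hom) (inter_subset_right.trans hnN) (fun θ hθ => hnB θ hθ.2)
    (fun x hx => (hratio x hx).1) hS hAS v
  have hlo := mul_shiftMass_le_setLIntegral hγ.measurableSet_nhd hγ.measurable hBm (hπ.mono hsub)
    hd' hs hom hDm (fun x hx => by
      obtain ⟨θ, hθ, rfl⟩ := hDex x hx
      exact hnB θ hθ)
    (hsat.mono fun θ h hθN hθD => h hθN (by
      obtain ⟨θ', hθ', h'⟩ := hDex _ hθD
      exact ⟨θ', hθ', h'⟩) (by
      have := mem_closedBall_zero_iff.1 hθD.2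
      rwa [norm_smul, Real.norm_of_nonneg (Real.sqrt_nonneg _)] at this))
    (by linarith) (fun x hx => (hratio x hx).2) v
  have hρ0 : 0 ≤ ρ := by linarith
  -- Of the three factors `ρ`, two come from replacing the density by `π 0` above and below, and one
  -- from replacing `T` by `D`.
  calc _ ≤ ENNReal.ofReal (ρ * π 0) * (ENNReal.ofReal |(s ^ d)⁻¹| * shiftMass v S) := hup
    _ ≤ ENNReal.ofReal (ρ * π 0) * (ENNReal.ofReal |(s ^ d)⁻¹|
          * (F * (ENNReal.ofReal ρ * shiftMass v D))) := by
        gcongr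
        exact hF.trans (by gcongr; exact hn v hv hvM)
    _ = ENNReal.ofReal ρ * ENNReal.ofReal ρ * F
          * (ENNReal.ofReal (π 0) * (ENNReal.ofReal |(s ^ d)⁻¹| * shiftMass v D)) := by
        rw [ENNReal.ofReal_mul hρ0]
        ring
    _ ≤ ENNReal.ofReal ρ * ENNReal.ofReal ρ * F
          * (ENNReal.ofReal ρ * ∫⁻ θ in Θosn n, shiftDensity v (s • γ θ) ∂prior) := by gcongr
    _ = _ := by
        rw [ENNReal.ofReal_pow hρ0]
        ring

end LocalBounds

/-! ### Bounds on quantiles from bounds on masses. -/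

section Quantile

variable {Θ : Type*} [MeasurableSpace Θ] {μ : Measure Θ} [IsProbabilityMeasure μ] {f : Θ → ℝ}
  {α c : ℝ}

theorem le_cdfQuantile_of_measure_lt (hα : α < 1) (h : μ {θ | f θ ≤ c} < ENNReal.ofReal α) :
    c ≤ cdfQuantile (fun z => μ.real {θ | f θ ≤ z}) α := by
  have hmono : Monotone fun z => μ.real {θ | f θ ≤ z} := fun a b hab =>
    measureReal_mono fun θ hθ => le_trans hθ hab
  have hlim : Tendsto (fun z : ℝ => μ {θ | f θ ≤ z}) atTop (𝓝 (μ (⋃ z : ℝ, {θ | f θ ≤ z}))) :=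
    tendsto_measure_iUnion_atTop fun a b hab θ hθ => le_trans hθ hab
  have hu : (⋃ z : ℝ, {θ | f θ ≤ z}) = univ :=
    eq_univ_of_forall fun θ => mem_iUnion.2 ⟨f θ, le_refl (f θ)⟩
  rw [hu, measure_univ] at hlim
  have hlim' : Tendsto (fun z : ℝ => μ.real {θ | f θ ≤ z}) atTop (𝓝 1) :=
    (ENNReal.tendsto_toReal ENNReal.one_ne_top).comp hlim
  refine le_csInf ((hlim'.eventually (lt_mem_nhds hα)).mono fun _ h => h.le).exists fun z hz => ?_
  by_contra! hzc
  have h1 : α ≤ μ.real {θ | f θ ≤ c} := le_trans hz (hmono hzc.le)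
  exact absurd ((ENNReal.ofReal_le_iff_le_toReal (measure_ne_top _ _)).2 h1) (not_le.2 h)

/-- The level `b` only witnesses that the set defining the quantile is bounded below, without which
`sInf` would take its default value. -/
theorem cdfQuantile_le_of_measure_lt (hf : Measurable f) {b : ℝ}
    (hb : μ {θ | f θ ≤ b} < ENNReal.ofReal α) (h : μ {θ | c < f θ} < ENNReal.ofReal (1 - α)) :
    cdfQuantile (fun z => μ.real {θ | f θ ≤ z}) α ≤ c := by
  have hmono : Monotone fun z => μ.real {θ | f θ ≤ z} := fun a b hab =>
    measureReal_mono fun θ hθ => le_trans hθ hab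
  refine csInf_le ⟨b, fun z hz => ?_⟩ ?_
  · by_contra! hzb
    have h1 : α ≤ μ.real {θ | f θ ≤ b} := le_trans hz (hmono hzb.le)
    exact absurd ((ENNReal.ofReal_le_iff_le_toReal (measure_ne_top _ _)).2 h1) (not_le.2 hb)
  · have h1 : {θ | f θ ≤ c} = {θ | c < f θ}ᶜ := by
      ext θ
      exact (not_lt (a := c) (b := f θ)).symm
    have h2 : μ.real {θ | c < f θ} < 1 - α := by
      rw [measureReal_def]
      exact (ENNReal.lt_ofReal_iff_toReal_lt (measure_ne_top _ _)).1 h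
    rw [mem_ofPred_eq]
    beta_reduce
    rw [h1, probReal_compl_eq_one_sub (measurableSet_lt measurable_const hf)]
    linarith

end Quantile

/-! ### From the quadratic approximation to quasi-posterior probabilities. -/

section Tilted

variable {Θ : Type*} [MeasurableSpace Θ] {d : ℕ} {prior : Measure Θ}

/-- The constant `a` and the normalizer cancel between the integrals over `A ∩ O` and `O`; an
exponent error `ε` in each costs `exp (2ε)`, and the mass of `O` is at most one. -/
theorem tilted_apply_le_of_quadratic {h : Θ → ℝ} {g : Θ → EuclideanSpace ℝ (Fin d)}
    {A O : Set Θ} (hA : MeasurableSet A) (hO : MeasurableSet O) {v : EuclideanSpace ℝ (Fin d)}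
    {a ε : ℝ} (hq : ∀ θ ∈ O, |h θ - (a - 1 / 2 * ‖v - g θ‖ ^ 2)| ≤ ε) {C : ℝ≥0∞}
    (hC : ∫⁻ θ in A ∩ O, shiftDensity v (g θ) ∂prior
      ≤ C * ∫⁻ θ in O, shiftDensity v (g θ) ∂prior) :
    prior.tilted h (A ∩ O) ≤ ENNReal.ofReal (Real.exp (2 * ε)) * C := by
  set Z := ∫ θ, Real.exp (h θ) ∂prior
  have hZ : 0 ≤ Z := integral_nonneg fun θ => (Real.exp_pos _).le
  set κ := gaussConst (EuclideanSpace ℝ (Fin d))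
  have hκ : 0 < κ := gaussConst_pos _
  have hw : ∀ θ, ∀ b : ℝ, ENNReal.ofReal (Real.exp b / (κ * Z)) * shiftDensity v (g θ)
      = ENNReal.ofReal (Real.exp (b - 1 / 2 * ‖v - g θ‖ ^ 2) / Z) := fun θ b => by
    rw [shiftDensity, gaussDensity, ← ENNReal.ofReal_mul (by positivity), norm_sub_rev,
      sub_eq_add_neg b, Real.exp_add, ← neg_mul]
    congr 1
    change Real.exp b / (κ * Z) * (κ * _) = _
    field_simp
  have hup : ∀ θ ∈ O, ENNReal.ofReal (Real.exp (h θ) / Z)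
      ≤ ENNReal.ofReal (Real.exp (a + ε) / (κ * Z)) * shiftDensity v (g θ) := fun θ hθ => by
    rw [hw]
    gcongr
    linarith [(abs_le.1 (hq θ hθ)).2]
  have hlo : ∀ θ ∈ O, ENNReal.ofReal (Real.exp (a - ε) / (κ * Z)) * shiftDensity v (g θ)
      ≤ ENNReal.ofReal (Real.exp (h θ) / Z) := fun θ hθ => by
    rw [hw]
    gcongr
    linarith [(abs_le.1 (hq θ hθ)).1]
  have hone : prior.tilted h O ≤ 1 := prob_le_one
  calc prior.tilted h (A ∩ O) = ∫⁻ θ in A ∩ O, ENNReal.ofReal (Real.exp (h θ) / Z) ∂prior :=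
        tilted_apply' _ _ (hA.inter hO)
    _ ≤ ∫⁻ θ in A ∩ O, ENNReal.ofReal (Real.exp (a + ε) / (κ * Z)) * shiftDensity v (g θ) ∂prior :=
        setLIntegral_mono' (hA.inter hO) fun θ hθ => hup θ hθ.2
    _ = ENNReal.ofReal (Real.exp (a + ε) / (κ * Z)) * ∫⁻ θ in A ∩ O, shiftDensity v (g θ) ∂prior :=
        lintegral_const_mul' _ _ ENNReal.ofReal_ne_top
    _ ≤ ENNReal.ofReal (Real.exp (a + ε) / (κ * Z))
          * (C * ∫⁻ θ in O, shiftDensity v (g θ) ∂prior) := by gcongr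
    _ = ENNReal.ofReal (Real.exp (2 * ε)) * C
          * (ENNReal.ofReal (Real.exp (a - ε) / (κ * Z)) * ∫⁻ θ in O, shiftDensity v (g θ) ∂prior) := by
        have : Real.exp (a + ε) / (κ * Z) = Real.exp (2 * ε) * (Real.exp (a - ε) / (κ * Z)) := by
          rw [← mul_div_assoc, ← Real.exp_add]
          ring_nf
        rw [this, ENNReal.ofReal_mul (Real.exp_pos _).le]
        ring
    _ = ENNReal.ofReal (Real.exp (2 * ε)) * C
          * ∫⁻ θ in O, ENNReal.ofReal (Real.exp (a - ε) / (κ * Z)) * shiftDensity v (g θ) ∂prior := by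
        rw [lintegral_const_mul' _ _ ENNReal.ofReal_ne_top]
    _ ≤ ENNReal.ofReal (Real.exp (2 * ε)) * C * prior.tilted h O := by
        rw [tilted_apply' _ _ hO]
        gcongr ENNReal.ofReal (Real.exp (2 * ε)) * C * ?_
        exact setLIntegral_mono' hO hlo
    _ ≤ ENNReal.ofReal (Real.exp (2 * ε)) * C * 1 := by gcongr
    _ = _ := mul_one _

end Tilted

/-! ### Deterministic posterior bounds at good realizations. -/

section GoodEvent

variable {Θ : Type*} [MeasurableSpace Θ] {d : ℕ} {prior : Measure Θ} {ΘI ΘN O : Set Θ}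
  {γ : Θ → EuclideanSpace ℝ (Fin d)} {Γ : Set (EuclideanSpace ℝ (Fin d))}
  {T : ProperCone ℝ (EuclideanSpace ℝ (Fin d))} {Θosn : ℕ → Set Θ}

/-- A realization `l` of the sample criterion at which the asymptotic approximations hold up to the
tolerance `ε`, with center `v` in the cone. -/
structure IsGoodRealization (prior : Measure Θ) (γ : Θ → EuclideanSpace ℝ (Fin d))
    (T : ProperCone ℝ (EuclideanSpace ℝ (Fin d))) (O : Set Θ) (ε M : ℝ) (n : ℕ)
    (l : Θ → ℝ) (lhat ℓ : ℝ) (v : EuclideanSpace ℝ (Fin d)) : Prop where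
  measurable : Measurable l
  mem : v ∈ T
  norm_le : ‖v‖ ≤ M
  quadratic : ∀ θ ∈ O, |n * l θ - (ℓ + 1 / 2 * ‖v‖ ^ 2 - 1 / 2 * ‖v - √(n : ℝ) • γ θ‖ ^ 2)| ≤ ε
  approx_max : |n * lhat - (ℓ + 1 / 2 * ‖v‖ ^ 2)| ≤ 3 * ε
  integrable : Integrable (fun θ => Real.exp (n * l θ)) prior
  compl_le : prior.tilted (fun θ => n * l θ) Oᶜ ≤ ENNReal.ofReal ε

/-- The term `ℓ + ½‖v‖²` cancels, and the errors `3ε` and `ε` are doubled. -/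
theorem IsGoodRealization.abs_sub_le {ε M : ℝ} {n : ℕ} {l : Θ → ℝ} {lhat ℓ : ℝ}
    {v : EuclideanSpace ℝ (Fin d)} (h : IsGoodRealization prior γ T O ε M n l lhat ℓ v) {θ : Θ}
    (hθ : θ ∈ O) : |2 * n * (lhat - l θ) - ‖v - √(n : ℝ) • γ θ‖ ^ 2| ≤ 8 * ε := by
  have h1 := abs_le.1 (h.quadratic θ hθ)
  have h2 := abs_le.1 h.approx_max
  rw [abs_le]
  constructor <;> linarith [h1.1, h1.2, h2.1, h2.2]

/-- The factor by which the bounds degrade at tolerance `ε` is negligible. -/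
theorem exists_tolerance {F β : ℝ} (hF : F < β) :
    ∃ ε₀ > 0, ∀ ε, 0 < ε → ε ≤ ε₀ → Real.exp (2 * ε) * ((1 + ε) ^ 3 * F) + ε < β := by
  have hc : Continuous fun ε : ℝ => Real.exp (2 * ε) * ((1 + ε) ^ 3 * F) + ε := by fun_prop
  have h := hc.tendsto 0
  simp only [mul_zero, Real.exp_zero, add_zero, one_pow, one_mul] at h
  obtain ⟨r, hr, hr'⟩ := Metric.eventually_nhds_iff.1 (h.eventually (gt_mem_nhds hF))
  refine ⟨r / 2, by linarith, fun ε h0 h1 => hr' ?_⟩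
  rw [dist_zero_right, Real.norm_of_nonneg h0.le]
  linarith

/-- The local bound is used with `ρ = 1 + ε`, and the part of `A` outside `Θosn` costs another `ε`.
The threshold for `n` precedes the realization, so it does not depend on the sample point. -/
theorem eventually_tilted_lt (hI : ΘI.Nonempty)
    (hγ : IsLocalReparam ΘI ΘN γ Γ) (hosn : IsLocalNhds prior ΘI ΘN γ T Θosn)
    (hdens : ∃ δ > 0, ∃ π : EuclideanSpace ℝ (Fin d) → ℝ,
      ContinuousOn π (Metric.ball 0 δ ∩ Γ) ∧ (∀ x ∈ Metric.ball 0 δ ∩ Γ, 0 < π x) ∧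
      ((prior.restrict ΘN).map γ).restrict (Metric.ball 0 δ ∩ Γ) =
        (volume.restrict (Metric.ball 0 δ ∩ Γ)).withDensity fun x => ENNReal.ofReal (π x))
    {F β ε : ℝ} (hF : 0 ≤ F) (hε : 0 < ε)
    (hβ : Real.exp (2 * ε) * ((1 + ε) ^ 3 * F) + ε < β) (M : ℝ) :
    ∀ᶠ n : ℕ in atTop, ∀ (l : Θ → ℝ) (lhat ℓ : ℝ) (v : EuclideanSpace ℝ (Fin d)),
      IsGoodRealization prior γ T (Θosn n) ε M n l lhat ℓ v → ∀ A : Set Θ, MeasurableSet A →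
      ∀ S : Set (EuclideanSpace ℝ (Fin d)), MeasurableSet S →
      (∀ θ ∈ A ∩ Θosn n, √(n : ℝ) • γ θ ∈ S) →
      shiftMass v S ≤ ENNReal.ofReal F * shiftMass v (T : Set _) →
      prior.tilted (fun θ => n * l θ) A < ENNReal.ofReal β := by
  filter_upwards [eventually_setLIntegral_shiftDensity_le hI hγ hosn hdens
    (by linarith : (1 : ℝ) < 1 + ε) M, eventually_ge_atTop 1] with n hn hn1 l lhat ℓ v hg A hA S hS
    hAS hS'
  have hb := tilted_apply_le_of_quadratic hA (hosn.measurableSet n hn1) hg.quadratic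
    (hn v hg.mem hg.norm_le A hA S hS hAS _ hS')
  calc prior.tilted (fun θ => n * l θ) A
      ≤ prior.tilted (fun θ => n * l θ) (A ∩ Θosn n)
        + prior.tilted (fun θ => n * l θ) (Θosn n)ᶜ := by
        refine (measure_mono fun θ hθ => ?_).trans (measure_union_le _ _)
        by_cases h : θ ∈ Θosn n
        · exact Or.inl ⟨hθ, h⟩
        · exact Or.inr h
    _ ≤ ENNReal.ofReal (Real.exp (2 * ε)) * (ENNReal.ofReal ((1 + ε) ^ 3) * ENNReal.ofReal F)
        + ENNReal.ofReal ε := add_le_add hb hg.compl_le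
    _ = ENNReal.ofReal (Real.exp (2 * ε) * ((1 + ε) ^ 3 * F) + ε) := by
        rw [ENNReal.ofReal_add (by positivity) hε.le, ENNReal.ofReal_mul (by positivity),
          ENNReal.ofReal_mul (by positivity)]
    _ < ENNReal.ofReal β := (ENNReal.ofReal_lt_ofReal_iff_of_nonneg (by positivity)).2 hβ

variable {α : ℝ}

/-- Below the quantile of the limit distribution, the quasi-posterior distribution function of the
quasi-likelihood ratio is eventually less than `α`. -/
theorem exists_eventually_tilted_le_lt (hI : ΘI.Nonempty)
    (hγ : IsLocalReparam ΘI ΘN γ Γ) (hosn : IsLocalNhds prior ΘI ΘN γ T Θosn)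
    (hdens : ∃ δ > 0, ∃ π : EuclideanSpace ℝ (Fin d) → ℝ,
      ContinuousOn π (Metric.ball 0 δ ∩ Γ) ∧ (∀ x ∈ Metric.ball 0 δ ∩ Γ, 0 < π x) ∧
      ((prior.restrict ΘN).map γ).restrict (Metric.ball 0 δ ∩ Γ) =
        (volume.restrict (Metric.ball 0 δ ∩ Γ)).withDensity fun x => ENNReal.ofReal (π x))
    (hα : α ∈ Ioo (0 : ℝ) 1)
    (hcont : ContinuousAt (coneCdf (T : Set (EuclideanSpace ℝ (Fin d))))
      (cdfQuantile (coneCdf (T : Set (EuclideanSpace ℝ (Fin d)))) α)) {c : ℝ}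
    (hc : c < cdfQuantile (coneCdf (T : Set (EuclideanSpace ℝ (Fin d)))) α) :
    ∃ ε₀ > 0, ∀ ε, 0 < ε → ε ≤ ε₀ → ∀ M : ℝ, ∀ᶠ n : ℕ in atTop,
      ∀ (l : Θ → ℝ) (lhat ℓ : ℝ) (v : EuclideanSpace ℝ (Fin d)),
      IsGoodRealization prior γ T (Θosn n) ε M n l lhat ℓ v →
      prior.tilted (fun θ => n * l θ) {θ | 2 * n * (lhat - l θ) ≤ c} < ENNReal.ofReal α := by
  set cα := cdfQuantile (coneCdf (T : Set (EuclideanSpace ℝ (Fin d)))) α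
  have hcα : 0 < cα := quantile_pos T hα hcont
  -- The gap `c' - c` absorbs the error `8ε`, and `c' > 0` is needed for the cone inequality.
  obtain ⟨c', hc', hc'α⟩ := exists_between (max_lt hc hcα)
  have hc'0 : 0 < c' := (le_max_right _ _).trans_lt hc'
  have hcc' : c < c' := (le_max_left _ _).trans_lt hc'
  obtain ⟨ε₁, hε₁, htol⟩ := exists_tolerance (coneCdf_lt_of_lt_quantile T hα.1 hc'α)
  refine ⟨min ε₁ ((c' - c) / 8), lt_min hε₁ (by linarith), fun ε hε hεle M => ?_⟩
  have hε2 : 8 * ε ≤ c' - c := by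
    have := hεle.trans (min_le_right _ _)
    linarith
  obtain ⟨-, k, hk, N, -, -, hTcl⟩ := hosn.covers
  filter_upwards [eventually_tilted_lt hI hγ hosn hdens (coneCdf_nonneg T c') hε
    (htol ε hε (hεle.trans (min_le_left _ _))) M, hk.eventually (eventually_ge_atTop (√c' + M)),
    eventually_ge_atTop N] with n hn hkn hnN l lhat ℓ v hg
  have hclos : IsClosed {y : EuclideanSpace ℝ (Fin d) | y ∈ T ∧ ‖y - v‖ ^ 2 ≤ c'} :=
    (isClosed_cone T).inter
      (isClosed_le (f := fun y : EuclideanSpace ℝ (Fin d) => ‖y - v‖ ^ 2) (by fun_prop)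
        continuous_const)
  refine hn l lhat ℓ v hg _ (measurableSet_le ?_ measurable_const)
    {y | y ∈ T ∧ ‖y - v‖ ^ 2 ≤ c'} hclos.measurableSet ?_ ?_
  · have := hg.measurable
    fun_prop
  · rintro θ ⟨hθ, hθO⟩
    have h1 := (abs_le.1 (hg.abs_sub_le hθO)).1
    have h2 : ‖√(n : ℝ) • γ θ - v‖ ^ 2 ≤ c' := by
      rw [norm_sub_rev]
      have : 2 * n * (lhat - l θ) ≤ c := hθ
      linarith
    refine ⟨?_, h2⟩
    -- Points with small quasi-likelihood ratio stay within `√c' + M ≤ k n`, where the rescaled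
    -- neighbourhood is contained in `T`.
    have h3 : ‖√(n : ℝ) • γ θ‖ ≤ k n := by
      have h4 := Real.le_sqrt_of_sq_le h2
      have h5 := norm_add_le (√(n : ℝ) • γ θ - v) v
      rw [sub_add_cancel] at h5
      linarith [hg.norm_le]
    have h6 : √(n : ℝ) • γ θ ∈ (T : Set (EuclideanSpace ℝ (Fin d))) := by
      rw [hTcl]
      refine subset_closure (mem_iUnion₂.2 ⟨n, hnN, ⟨θ, hθO, rfl⟩, ?_⟩)
      exact mem_closedBall_zero_iff.2 h3
    exact h6
  · rw [shiftMass_eq _ hclos.measurableSet, shiftMass_eq _ (isClosed_cone T).measurableSet, mul_comm]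
    simpa using! stdGaussian_translate_cone_le T hg.mem hc'0.le

/-- When the cone is the whole space, above the quantile of the limit distribution the
quasi-posterior tail of the quasi-likelihood ratio is eventually less than `1 - α`. -/
theorem exists_eventually_tilted_gt_lt (hd : 1 ≤ d) (hI : ΘI.Nonempty)
    (hγ : IsLocalReparam ΘI ΘN γ Γ) (hosn : IsLocalNhds prior ΘI ΘN γ T Θosn)
    (hdens : ∃ δ > 0, ∃ π : EuclideanSpace ℝ (Fin d) → ℝ,
      ContinuousOn π (Metric.ball 0 δ ∩ Γ) ∧ (∀ x ∈ Metric.ball 0 δ ∩ Γ, 0 < π x) ∧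
      ((prior.restrict ΘN).map γ).restrict (Metric.ball 0 δ ∩ Γ) =
        (volume.restrict (Metric.ball 0 δ ∩ Γ)).withDensity fun x => ENNReal.ofReal (π x))
    (hα : α ∈ Ioo (0 : ℝ) 1)
    (hcont : ContinuousAt (coneCdf (T : Set (EuclideanSpace ℝ (Fin d))))
      (cdfQuantile (coneCdf (T : Set (EuclideanSpace ℝ (Fin d)))) α))
    (hT : (T : Set (EuclideanSpace ℝ (Fin d))) = univ) {c : ℝ}
    (hc : cdfQuantile (coneCdf (T : Set (EuclideanSpace ℝ (Fin d)))) α < c) :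
    ∃ ε₀ > 0, ∀ ε, 0 < ε → ε ≤ ε₀ → ∀ M : ℝ, ∀ᶠ n : ℕ in atTop,
      ∀ (l : Θ → ℝ) (lhat ℓ : ℝ) (v : EuclideanSpace ℝ (Fin d)),
      IsGoodRealization prior γ T (Θosn n) ε M n l lhat ℓ v →
      prior.tilted (fun θ => n * l θ) {θ | c < 2 * n * (lhat - l θ)} < ENNReal.ofReal (1 - α) := by
  set cα := cdfQuantile (coneCdf (T : Set (EuclideanSpace ℝ (Fin d)))) α
  have hcα : 0 < cα := quantile_pos T hα hcont
  obtain ⟨c', hc'α, hc'⟩ := exists_between hc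
  have hF : 1 - coneCdf (T : Set (EuclideanSpace ℝ (Fin d))) c' < 1 - α := by
    have h1 := coneCdf_lt_of_lt T hd hT hcα.le hc'α
    rw [coneCdf_quantile T hα hcont] at h1
    linarith
  have hF0 : 0 ≤ 1 - coneCdf (T : Set (EuclideanSpace ℝ (Fin d))) c' := by
    have : coneCdf (T : Set (EuclideanSpace ℝ (Fin d))) c' ≤ 1 := measureReal_le_one
    linarith
  obtain ⟨ε₁, hε₁, htol⟩ := exists_tolerance hF
  refine ⟨min ε₁ ((c - c') / 8), lt_min hε₁ (by linarith), fun ε hε hεle M => ?_⟩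
  have hε2 : 8 * ε ≤ c - c' := by
    have := hεle.trans (min_le_right _ _)
    linarith
  filter_upwards [eventually_tilted_lt hI hγ hosn hdens hF0 hε
    (htol ε hε (hεle.trans (min_le_left _ _))) M] with n hn l lhat ℓ v hg
  have hopen : IsOpen {y : EuclideanSpace ℝ (Fin d) | c' < ‖y - v‖ ^ 2} :=
    isOpen_lt continuous_const (by fun_prop)
  refine hn l lhat ℓ v hg _ (measurableSet_lt measurable_const ?_)
    {y | c' < ‖y - v‖ ^ 2} hopen.measurableSet ?_ ?_
  · have := hg.measurable
    fun_prop
  · rintro θ ⟨hθ, hθO⟩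
    have h1 := (abs_le.1 (hg.abs_sub_le hθO)).2
    have h3 : c < 2 * n * (lhat - l θ) := hθ
    rw [mem_ofPred_eq, norm_sub_rev]
    linarith
  · have hm : MeasurableSet {z : EuclideanSpace ℝ (Fin d) | ‖z‖ ^ 2 ≤ c'} :=
      measurableSet_le (by fun_prop) measurable_const
    have hcompl : {z : EuclideanSpace ℝ (Fin d) | z + v ∈ {y | c' < ‖y - v‖ ^ 2}}
        = {z | ‖z‖ ^ 2 ≤ c'}ᶜ := by
      ext z
      simp
    -- With no truncation the conditional law is Gaussian, so the tail is exactly `1 - F_T(c')`.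
    rw [hT, shiftMass_eq _ hopen.measurableSet, shiftMass_eq _ MeasurableSet.univ, hcompl]
    simp only [mem_univ, ofPred_true, measure_univ, mul_one]
    rw [← ENNReal.ofReal_toReal (measure_ne_top (stdGaussian _) _), ← measureReal_def,
      probReal_compl_eq_one_sub hm, ← hT]
    simp only [coneCdf, metricProj_of_eq_univ T hT, le_refl]

end GoodEvent

/-! ### Extended-real suprema, portmanteau and tightness. -/

section Auxiliary

variable {Ω Θ : Type*} [MeasurableSpace Ω] [MeasurableSpace Θ]

/-- The supremum lies between `l θ'` and `b / n`, hence is a real number and the extended arithmetic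
reduces to real arithmetic. -/
theorem abs_le_of_ereal_abs_lt {O : Set Θ} {l : Θ → ℝ} {lhat b b' ε : ℝ} {n : ℕ} (hn : 1 ≤ n)
    (h : ((n : EReal) * ((lhat : EReal) - ⨆ θ ∈ O, (l θ : EReal))).abs < ENNReal.ofReal ε)
    (hb : ∀ θ ∈ O, n * l θ ≤ b) (hb' : ∃ θ ∈ O, b' ≤ n * l θ) :
    n * lhat ≤ b + ε ∧ b' - ε ≤ n * lhat := by
  have hn0 : (0 : ℝ) < n := by exact_mod_cast hn
  obtain ⟨θ', hθ', hbθ'⟩ := hb'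
  have h1 : (⨆ θ ∈ O, (l θ : EReal)) ≤ ((b / n : ℝ) : EReal) := iSup₂_le fun θ hθ => by
    rw [EReal.coe_le_coe_iff, le_div_iff₀ hn0, mul_comm]
    exact hb θ hθ
  have h2 : ((l θ' : ℝ) : EReal) ≤ ⨆ θ ∈ O, (l θ : EReal) :=
    le_iSup₂ (f := fun θ (_ : θ ∈ O) => (l θ : EReal)) θ' hθ'
  obtain ⟨s, hs⟩ : ∃ s : ℝ, (s : EReal) = ⨆ θ ∈ O, (l θ : EReal) :=
    ⟨_, EReal.coe_toReal (h1.trans_lt (EReal.coe_lt_top _)).ne ((EReal.bot_lt_coe _).trans_le h2).ne'⟩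
  rw [← hs] at h h1 h2
  rw [EReal.coe_le_coe_iff] at h1 h2
  rw [← EReal.coe_coe_eq_natCast, ← EReal.coe_sub, ← EReal.coe_mul, EReal.abs_def] at h
  have h3 := abs_lt.1 ((ENNReal.ofReal_lt_ofReal_iff_of_nonneg (abs_nonneg _)).1 h)
  rw [le_div_iff₀ hn0] at h1
  have h4 : n * l θ' ≤ n * s := by gcongr
  constructor <;> nlinarith [h3.1, h3.2]

theorem IsOpOne.tendsto_measure_not_lt {P : Measure Ω} {R : ℕ → Ω → ℝ≥0∞} (h : IsOpOne P R)
    {ε : ℝ} (hε : 0 < ε) : Tendsto (fun n => P {ω | ¬R n ω < ENNReal.ofReal ε}) atTop (𝓝 0) := by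
  simpa only [not_lt] using h _ (ENNReal.ofReal_pos.2 hε).ne'

variable {E : Type*} [NormedAddCommGroup E] [InnerProductSpace ℝ E] [FiniteDimensional ℝ E]
  [MeasurableSpace E] [BorelSpace E]

theorem eventually_measure_lt_of_isClosed {P : Measure Ω} [IsProbabilityMeasure P] {V : ℕ → Ω → E}
    {μ : Measure E} [IsProbabilityMeasure μ] (hV : TendstoInDistribution V atTop id (fun _ => P) μ)
    {F : Set E} (hF : IsClosed F) {η : ℝ≥0∞} (h : μ F < η) :
    ∀ᶠ n in atTop, P {ω | V n ω ∈ F} < η := by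
  have h1 := ProbabilityMeasure.limsup_measure_closed_le_of_tendsto hV.tendsto hF
  have h2 : ∀ n, P {ω | V n ω ∈ F} = (P.map (V n)) F := fun n =>
    (Measure.map_apply_of_aemeasurable (hV.forall_aemeasurable n) hF.measurableSet).symm
  simp_rw [h2]
  refine eventually_lt_of_limsup_lt (h1.trans_lt ?_)
  simpa using h

/-- Tightness: the closed sets `{m ≤ ‖x‖}` decrease to the empty set under the limit law, and
portmanteau transfers the bound. -/
theorem exists_eventually_measure_norm_ge_lt {P : Measure Ω} [IsProbabilityMeasure P]
    {V : ℕ → Ω → E} {μ : Measure E} [IsProbabilityMeasure μ]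
    (hV : TendstoInDistribution V atTop id (fun _ => P) μ) {η : ℝ≥0∞} (hη : η ≠ 0) :
    ∃ M : ℝ, ∀ᶠ n in atTop, P {ω | M ≤ ‖V n ω‖} < η := by
  have hcl : ∀ m : ℕ, IsClosed {x : E | (m : ℝ) ≤ ‖x‖} := fun m =>
    isClosed_le continuous_const continuous_norm
  have h := tendsto_measure_iInter_atTop (μ := μ) (s := fun m : ℕ => {x : E | (m : ℝ) ≤ ‖x‖})
    (fun m => (hcl m).measurableSet.nullMeasurableSet)
    (fun m m' hm x (hx : (m' : ℝ) ≤ ‖x‖) => le_trans (by exact_mod_cast hm) hx)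
    ⟨0, measure_ne_top _ _⟩
  have h0 : (⋂ m : ℕ, {x : E | (m : ℝ) ≤ ‖x‖}) = ∅ := by
    refine eq_empty_of_forall_notMem fun x hx => ?_
    obtain ⟨m, hm⟩ := exists_nat_gt ‖x‖
    have : (m : ℝ) ≤ ‖x‖ := mem_iInter.1 hx m
    linarith
  rw [h0, measure_empty] at h
  obtain ⟨m, hm⟩ := (h.eventually (gt_mem_nhds (pos_iff_ne_zero.2 hη))).exists
  exact ⟨m, eventually_measure_lt_of_isClosed hV (hcl m) hm⟩

theorem measure_le_of_forall_mem {P : Measure Ω} {s a b c e f z : Set Ω} {η : ℝ≥0∞}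
    (ha : P a ≤ η / 2) (hb : P b + P c + (P e + P f) ≤ η / 2) (hz : P z = 0)
    (h : ∀ ω ∈ s, ω ∈ a ∨ ω ∈ b ∨ ω ∈ c ∨ ω ∈ e ∨ ω ∈ f ∨ ω ∈ z) : P s ≤ η := by
  have h1 : s ⊆ (a ∪ ((b ∪ c) ∪ (e ∪ f))) ∪ z := fun ω hω => by
    rcases h ω hω with h | h | h | h | h | h <;> simp [h]
  refine (measure_mono h1).trans ((measure_union_le _ _).trans ?_)
  rw [hz, add_zero, ← ENNReal.add_halves η]
  refine (measure_union_le _ _).trans (add_le_add ha (((measure_union_le _ _).trans ?_).trans hb))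
  exact add_le_add (measure_union_le _ _) (measure_union_le _ _)

theorem innerProb_le {P : Measure Ω} [IsProbabilityMeasure P] (A : Set Ω) :
    innerProb P A ≤ P A := by
  rw [innerProb, tsub_le_iff_right, ← measure_univ (μ := P), ← union_compl_self A]
  exact measure_union_le _ _

end Auxiliary

/-! ### Good realizations have probability close to one. -/

section GoodProbability

variable {Ω 𝒳 Θ : Type*} [MeasurableSpace Ω] [MeasurableSpace 𝒳] [MeasurableSpace Θ]
  {P : Measure Ω} [IsProbabilityMeasure P] {X : ℕ → Ω → 𝒳}
  {crit : (n : ℕ) → (Fin n → 𝒳) → Θ → ℝ} {prior : Measure Θ} {θhat : ℕ → Ω → Θ}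
  {d : ℕ} {ΘI ΘN : Set Θ} {γ : Θ → EuclideanSpace ℝ (Fin d)}
  {T : ProperCone ℝ (EuclideanSpace ℝ (Fin d))} {Θosn : ℕ → Set Θ}

/-- Points of `T` have distance zero to `T`, so uniform convergence of squared distances puts
rescaled parameters near every bounded one. -/
theorem IsLocalNhds.eventually_exists_norm_sub_sq_lt (hI : ΘI.Nonempty)
    (hosn : IsLocalNhds prior ΘI ΘN γ T Θosn) {ε : ℝ} (hε : 0 < ε) (M : ℝ) :
    ∀ᶠ n : ℕ in atTop, ∀ v ∈ T, ‖v‖ ≤ M → ∃ θ ∈ Θosn n, ‖v - √(n : ℝ) • γ θ‖ ^ 2 < ε := by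
  have h := Metric.tendstoUniformlyOn_iff.1 (hosn.covers.1 M) ε hε
  filter_upwards [h, eventually_ge_atTop 1] with n hn hn1 v hv hvM
  have h1 := hn v (mem_closedBall_zero_iff.2 hvM)
  rw [Metric.infDist_zero_of_mem (show v ∈ (T : Set (EuclideanSpace ℝ (Fin d))) from hv), zero_pow two_ne_zero, dist_zero_left,
    Real.norm_of_nonneg (by positivity)] at h1
  obtain ⟨θ₀, hθ₀⟩ := hI
  have h2 : Metric.infDist v ((fun θ => √(n : ℝ) • γ θ) '' Θosn n) < √ε :=
    Real.lt_sqrt_of_sq_lt h1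
  -- Nonemptiness of `Θosn` matters, since `infDist` to the empty set is `0`.
  rw [Metric.infDist_lt_iff (Set.Nonempty.image _ ⟨θ₀, hosn.subset n hn1 hθ₀⟩)] at h2
  obtain ⟨_, ⟨θ, hθ, rfl⟩, h3⟩ := h2
  refine ⟨θ, hθ, ?_⟩
  rw [dist_eq_norm] at h3
  exact (Real.lt_sqrt (norm_nonneg _)).1 h3

/-- With probability close to one, the sample criterion is a good realization and the Monte Carlo
critical value is close to the posterior quantile. -/
theorem exists_eventually_measure_not_good (hI : ΘI.Nonempty)
    (hcrit : ∀ n, Measurable (Function.uncurry (crit n)))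
    (hosn : IsLocalNhds prior ΘI ΘN γ T Θosn)
    (hrate : PosteriorContraction P prior (criterion X crit) θhat Θosn)
    (hproper : ∀ n ≥ 1, ∀ᵐ ω ∂P,
      Integrable (fun θ => Real.exp (n * criterion X crit n ω θ)) prior)
    {α : ℝ} {ζ : ℕ → Ω → ℝ} (hmc : MCConvergence P prior (criterion X crit) θhat ζ α)
    {ℓ : (n : ℕ) → (Fin n → 𝒳) → ℝ} {γhat : (n : ℕ) → (Fin n → 𝒳) → EuclideanSpace ℝ (Fin d)}
    {V : ℕ → Ω → EuclideanSpace ℝ (Fin d)}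
    (hquad : IsOpOne P fun n ω => ⨆ θ ∈ Θosn n,
      ‖n * criterion X crit n ω θ - (ℓ n (sample X n ω)
          + 1 / 2 * ‖√(n : ℝ) • γhat n (sample X n ω)‖ ^ 2
          - 1 / 2 * ‖√(n : ℝ) • (γhat n (sample X n ω) - γ θ)‖ ^ 2)‖ₑ)
    (hproj : ∀ n : ℕ, 1 ≤ n → ∀ᵐ ω ∂P, √(n : ℝ) • γhat n (sample X n ω) = metricProj T (V n ω))
    (hV : TendstoInDistribution V atTop id (fun _ => P)
      (stdGaussian (EuclideanSpace ℝ (Fin d))))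
    {ε : ℝ} (hε : 0 < ε) {η : ℝ≥0∞} (hη : η ≠ 0) :
    ∃ M : ℝ, ∀ᶠ n in atTop, P {ω | ¬(IsGoodRealization prior γ T (Θosn n) ε M n
        (criterion X crit n ω) (criterion X crit n ω (θhat n ω)) (ℓ n (sample X n ω))
        (metricProj T (V n ω)) ∧
      |qlrCritical (criterion X crit) θhat ζ n ω
        - postQuantile prior (criterion X crit) θhat α n ω| ≤ ε)} ≤ η := by
  obtain ⟨M, hM⟩ := exists_eventually_measure_norm_ge_lt hV (ENNReal.half_pos hη).ne'
  refine ⟨M, ?_⟩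
  have hlim := ((hquad.tendsto_measure_not_lt hε).add
    (hrate.approx_max.tendsto_measure_not_lt hε)).add
    ((hrate.contraction.tendsto_measure_not_lt hε).add (IsOpOne.tendsto_measure_not_lt hmc hε))
  simp only [add_zero] at hlim
  filter_upwards [hM, hlim.eventually (gt_mem_nhds (ENNReal.half_pos hη)), eventually_ge_atTop 1,
    hosn.eventually_exists_norm_sub_sq_lt hI hε M] with n hnM hnlim hn1 hcov
  have hnull : P {ω | ¬(√(n : ℝ) • γhat n (sample X n ω) = metricProj T (V n ω) ∧
      Integrable (fun θ => Real.exp (n * criterion X crit n ω θ)) prior)} = 0 :=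
    ae_iff.1 ((hproj n hn1).and (hproper n hn1))
  refine measure_le_of_forall_mem hnM.le hnlim.le hnull fun ω hω => ?_
  by_contra hcon
  simp only [mem_ofPred_eq, not_or, not_not, not_le] at hcon
  rw [mem_ofPred_eq] at hω
  obtain ⟨hVM, hq, ha, hc, hm, hp, hint⟩ := hcon
  refine hω ⟨?_, ?_⟩
  · set v := metricProj T (V n ω)
    have hvT : v ∈ T := (isProj_metricProj T).mem _
    have hvM : ‖v‖ ≤ M := (norm_metricProj_le T _).trans hVM.le
    have hquad' : ∀ θ ∈ Θosn n, |n * criterion X crit n ω θ - (ℓ n (sample X n ω)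
        + 1 / 2 * ‖v‖ ^ 2 - 1 / 2 * ‖v - √(n : ℝ) • γ θ‖ ^ 2)| ≤ ε := fun θ hθ => by
      have h1 := (le_iSup₂ (f := fun θ (_ : θ ∈ Θosn n) =>
        ‖n * criterion X crit n ω θ - (ℓ n (sample X n ω)
          + 1 / 2 * ‖√(n : ℝ) • γhat n (sample X n ω)‖ ^ 2
          - 1 / 2 * ‖√(n : ℝ) • (γhat n (sample X n ω) - γ θ)‖ ^ 2)‖ₑ) θ hθ).trans_lt hq
      rw [smul_sub, hp, ← ofReal_norm, ENNReal.ofReal_lt_ofReal_iff hε] at h1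
      exact h1.le
    refine ⟨(hcrit n).comp measurable_prodMk_left, hvT, hvM, hquad', ?_, hint, hc.le⟩
    obtain ⟨θ₁, hθ₁, hd₁⟩ := hcov v hvT hvM
    -- The quadratic peak is at most `ℓ + ½‖v‖²`, and at `θ₁` it falls short by less than `ε/2`.
    -- With the approximation error `ε` this lies within `2ε`, and approximate maximization adds the
    -- last `ε`.
    have h2 := abs_le_of_ereal_abs_lt (b := ℓ n (sample X n ω) + 1 / 2 * ‖v‖ ^ 2 + ε)
      (b' := ℓ n (sample X n ω) + 1 / 2 * ‖v‖ ^ 2 - 2 * ε) hn1 ha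
      (fun θ hθ => by
        have := (abs_le.1 (hquad' θ hθ)).2
        nlinarith [sq_nonneg ‖v - √(n : ℝ) • γ θ‖])
      ⟨θ₁, hθ₁, by
        have := (abs_le.1 (hquad' θ₁ hθ₁)).1
        linarith⟩
    rw [abs_le]
    constructor <;> linarith [h2.1, h2.2]
  · rw [← ofReal_norm, ENNReal.ofReal_lt_ofReal_iff hε] at hm
    exact hm.le

end GoodProbability

/-! ### Coverage bounds for the confidence set. -/

section Coverage

variable {Ω 𝒳 Θ : Type*} [MeasurableSpace Ω] [MeasurableSpace 𝒳] [MeasurableSpace Θ]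
  {P : Measure Ω} [IsProbabilityMeasure P] {X : ℕ → Ω → 𝒳}
  {crit : (n : ℕ) → (Fin n → 𝒳) → Θ → ℝ} {prior : Measure Θ} {θhat : ℕ → Ω → Θ}
  {d : ℕ} {ΘI ΘN : Set Θ} {γ : Θ → EuclideanSpace ℝ (Fin d)}
  {Γ : Set (EuclideanSpace ℝ (Fin d))}
  {T : ProperCone ℝ (EuclideanSpace ℝ (Fin d))} {Θosn : ℕ → Set Θ} {α : ℝ} {ζ : ℕ → Ω → ℝ}

theorem IsGoodRealization.abs_sub_le_of_mem {ε M : ℝ} {n : ℕ} {l : Θ → ℝ} {lhat ℓ : ℝ}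
    {v : EuclideanSpace ℝ (Fin d)}
    (h : IsGoodRealization prior γ T (Θosn n) ε M n l lhat ℓ v) (hn : 1 ≤ n)
    (hγ : IsLocalReparam ΘI ΘN γ Γ) (hosn : IsLocalNhds prior ΘI ΘN γ T Θosn) {θ : Θ}
    (hθ : θ ∈ ΘI) : |2 * n * (lhat - l θ) - ‖v‖ ^ 2| ≤ 8 * ε := by
  have h0 : γ θ = 0 := (hγ.eq_zero_iff θ (hγ.subset_nhd hθ)).2 hθ
  simpa [h0] using h.abs_sub_le (hosn.subset n hn hθ)

theorem measure_lt_of_forall_mem {s s₁ s₂ : Set Ω} {b b' : ℝ≥0∞} (h₁ : P s₁ ≤ b - b')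
    (h₂ : P s₂ < b') (hb : b' < b) (h : ∀ ω ∈ s, ω ∈ s₁ ∨ ω ∈ s₂) : P s < b :=
  calc P s ≤ P s₁ + P s₂ := (measure_mono fun ω hω => h ω hω).trans (measure_union_le _ _)
    _ < (b - b') + b' := ENNReal.add_lt_add_of_le_of_lt (measure_ne_top P _) h₁ h₂
    _ = b := tsub_add_cancel_of_le hb.le

/-- At a good realization with `‖𝐓Vₙ‖² < x`, every `θ ∈ ΘI` has ratio below `x + 8ε ≤ c - ε`, while
the Monte Carlo critical value is at least the posterior quantile minus `ε`, hence at least `c - ε`.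
Failure of coverage thus forces a bad realization or `‖𝐓Vₙ‖² ≥ x`. -/
theorem eventually_measure_not_subset_lt [NeZero prior] (hI : ΘI.Nonempty)
    (hcrit : ∀ n, Measurable (Function.uncurry (crit n)))
    (hγ : IsLocalReparam ΘI ΘN γ Γ) (hosn : IsLocalNhds prior ΘI ΘN γ T Θosn)
    (hrate : PosteriorContraction P prior (criterion X crit) θhat Θosn)
    (hquad : LocalQuadraticApprox P X crit γ T Θosn 1)
    (hpri : PriorCondition P prior (criterion X crit) ΘN γ Γ) (hα : α ∈ Ioo (0 : ℝ) 1)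
    (hmc : MCConvergence P prior (criterion X crit) θhat ζ α)
    (hcont : ContinuousAt (coneCdf (T : Set (EuclideanSpace ℝ (Fin d))))
      (cdfQuantile (coneCdf (T : Set (EuclideanSpace ℝ (Fin d)))) α)) {x : ℝ}
    (hx : x < cdfQuantile (coneCdf (T : Set (EuclideanSpace ℝ (Fin d)))) α) {b : ℝ≥0∞}
    (hb : (stdGaussian (EuclideanSpace ℝ (Fin d))) {z | x ≤ ‖metricProj T z‖ ^ 2} < b) :
    ∀ᶠ n in atTop, P {ω | ΘI ⊆ confidenceSet (criterion X crit) ζ n ω}ᶜ < b := by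
  obtain ⟨ℓ, γhat, V, -, -, hquad, hproj, hV⟩ := hquad
  simp only [multivariateGaussian_zero_one] at hV
  obtain ⟨c, hxc, hc⟩ := exists_between hx
  obtain ⟨ε₀, hε₀, hpost⟩ := exists_eventually_tilted_le_lt hI hγ hosn hpri.density hα hcont hc
  set ε := min ε₀ ((c - x) / 9)
  have hε : 0 < ε := lt_min hε₀ (by linarith)
  have hε9 : 9 * ε ≤ c - x := by
    have : ε ≤ (c - x) / 9 := min_le_right _ _
    linarith
  obtain ⟨b', hxb', hb'⟩ := exists_between hb
  obtain ⟨M, hM⟩ := exists_eventually_measure_not_good hI hcrit hosn hrate hpri.proper hmc hquad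
    hproj hV hε (tsub_pos_of_lt hb').ne'
  have hcl : IsClosed {z : EuclideanSpace ℝ (Fin d) | x ≤ ‖metricProj T z‖ ^ 2} :=
    isClosed_le continuous_const ((continuous_metricProj T).norm.pow 2)
  filter_upwards [hM, eventually_measure_lt_of_isClosed hV hcl hxb',
    hpost ε hε (min_le_left _ _) M, eventually_ge_atTop 1] with n hnM hnV hnp hn1
  refine measure_lt_of_forall_mem hnM hnV hb' fun ω hω => ?_
  by_contra hcon
  rw [not_or] at hcon
  obtain ⟨h1, h2⟩ := hcon
  refine hω fun θ hθ => ?_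
  have hg := not_not.1 h1
  have hVx : ‖metricProj T (V n ω)‖ ^ 2 < x := not_le.1 h2
  have hprob : IsProbabilityMeasure (quasiPosterior prior (criterion X crit) n ω) :=
    isProbabilityMeasure_tilted hg.1.integrable
  have hq : c ≤ postQuantile prior (criterion X crit) θhat α n ω :=
    le_cdfQuantile_of_measure_lt hα.2 (hnp _ _ _ _ hg.1)
  have h3 := (abs_le.1 hg.2).1
  have h4 := (abs_le.1 (hg.1.abs_sub_le_of_mem hn1 hγ hosn hθ)).2
  have hn0 : (0 : ℝ) < n := by exact_mod_cast hn1
  have h5 : 2 * n * (criterion X crit n ω (θhat n ω) - criterion X crit n ω θ)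
      ≤ 2 * n * (criterion X crit n ω (θhat n ω) - ζ n ω) := by
    rw [qlrCritical] at h3
    linarith
  have h6 := le_of_mul_le_mul_left h5 (by positivity)
  change ζ n ω ≤ criterion X crit n ω θ
  linarith

/-- Conversely, covering a single `θ₀ ∈ ΘI` at a good realization forces `‖𝐓Vₙ‖² ≤ c + 9ε ≤ x`. -/
theorem eventually_measure_subset_lt [NeZero prior] (hd : 1 ≤ d) (hI : ΘI.Nonempty)
    (hcrit : ∀ n, Measurable (Function.uncurry (crit n)))
    (hγ : IsLocalReparam ΘI ΘN γ Γ) (hosn : IsLocalNhds prior ΘI ΘN γ T Θosn)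
    (hrate : PosteriorContraction P prior (criterion X crit) θhat Θosn)
    (hquad : LocalQuadraticApprox P X crit γ T Θosn 1)
    (hpri : PriorCondition P prior (criterion X crit) ΘN γ Γ) (hα : α ∈ Ioo (0 : ℝ) 1)
    (hmc : MCConvergence P prior (criterion X crit) θhat ζ α)
    (hcont : ContinuousAt (coneCdf (T : Set (EuclideanSpace ℝ (Fin d))))
      (cdfQuantile (coneCdf (T : Set (EuclideanSpace ℝ (Fin d)))) α))
    (hT : (T : Set (EuclideanSpace ℝ (Fin d))) = univ) {x : ℝ}
    (hx : cdfQuantile (coneCdf (T : Set (EuclideanSpace ℝ (Fin d)))) α < x) {b : ℝ≥0∞}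
    (hb : (stdGaussian (EuclideanSpace ℝ (Fin d))) {z | ‖metricProj T z‖ ^ 2 ≤ x} < b) :
    ∀ᶠ n in atTop, P {ω | ΘI ⊆ confidenceSet (criterion X crit) ζ n ω} < b := by
  obtain ⟨ℓ, γhat, V, -, -, hquad, hproj, hV⟩ := hquad
  simp only [multivariateGaussian_zero_one] at hV
  obtain ⟨c, hc, hxc⟩ := exists_between hx
  obtain ⟨ε₀, hε₀, hpost⟩ := exists_eventually_tilted_gt_lt hd hI hγ hosn hpri.density hα hcont hT hc
  -- The lower bound at level `0` serves only to bound the posterior quantile set below.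
  obtain ⟨ε₁, hε₁, hpost'⟩ := exists_eventually_tilted_le_lt hI hγ hosn hpri.density hα hcont
    (quantile_pos T hα hcont)
  set ε := min (min ε₀ ε₁) ((x - c) / 9)
  have hε : 0 < ε := lt_min (lt_min hε₀ hε₁) (by linarith)
  have hε9 : 9 * ε ≤ x - c := by
    have : ε ≤ (x - c) / 9 := min_le_right _ _
    linarith
  obtain ⟨b', hxb', hb'⟩ := exists_between hb
  obtain ⟨M, hM⟩ := exists_eventually_measure_not_good hI hcrit hosn hrate hpri.proper hmc hquad
    hproj hV hε (tsub_pos_of_lt hb').ne'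
  have hcl : IsClosed {z : EuclideanSpace ℝ (Fin d) | ‖metricProj T z‖ ^ 2 ≤ x} :=
    isClosed_le ((continuous_metricProj T).norm.pow 2) continuous_const
  obtain ⟨θ₀, hθ₀⟩ := hI
  filter_upwards [hM, eventually_measure_lt_of_isClosed hV hcl hxb',
    hpost ε hε ((min_le_left _ _).trans (min_le_left _ _)) M,
    hpost' ε hε ((min_le_left _ _).trans (min_le_right _ _)) M,
    eventually_ge_atTop 1] with n hnM hnV hnp hnp' hn1
  refine measure_lt_of_forall_mem hnM hnV hb' fun ω hω => ?_
  by_contra hcon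
  rw [not_or] at hcon
  obtain ⟨h1, h2⟩ := hcon
  refine h2 ?_
  have hg := not_not.1 h1
  have hprob : IsProbabilityMeasure (quasiPosterior prior (criterion X crit) n ω) :=
    isProbabilityMeasure_tilted hg.1.integrable
  have hmeas : Measurable fun θ => qlr (criterion X crit) θhat n ω θ := by
    have := hg.1.measurable
    unfold qlr
    fun_prop
  have hq : postQuantile prior (criterion X crit) θhat α n ω ≤ c :=
    cdfQuantile_le_of_measure_lt hmeas (hnp' _ _ _ _ hg.1) (hnp _ _ _ _ hg.1)
  have h3 := (abs_le.1 hg.2).2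
  have h4 := (abs_le.1 (hg.1.abs_sub_le_of_mem hn1 hγ hosn hθ₀)).1
  have h5 : ζ n ω ≤ criterion X crit n ω θ₀ := hω hθ₀
  have h6 : 2 * n * (criterion X crit n ω (θhat n ω) - criterion X crit n ω θ₀)
      ≤ 2 * n * (criterion X crit n ω (θhat n ω) - ζ n ω) := by gcongr
  rw [qlrCritical] at h3
  change ‖metricProj T (V n ω)‖ ^ 2 ≤ x
  linarith

/-- Just below the quantile, the upper tail of `‖𝐓Z‖²` has mass close to `1 - α`. -/
theorem exists_lt_quantile_measure_lt (hα : α ∈ Ioo (0 : ℝ) 1)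
    (hcont : ContinuousAt (coneCdf (T : Set (EuclideanSpace ℝ (Fin d))))
      (cdfQuantile (coneCdf (T : Set (EuclideanSpace ℝ (Fin d)))) α)) {β : ℝ} (hβ : 1 - α < β) :
    ∃ x < cdfQuantile (coneCdf (T : Set (EuclideanSpace ℝ (Fin d)))) α,
      (stdGaussian (EuclideanSpace ℝ (Fin d))) {z | x ≤ ‖metricProj T z‖ ^ 2}
        < ENNReal.ofReal β := by
  have h := hcont.tendsto.eventually (lt_mem_nhds (a := 1 - β) (by
    rw [coneCdf_quantile T hα hcont]
    linarith))
  obtain ⟨x', hx', hlt⟩ := ((h.filter_mono (nhdsWithin_le_nhds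
    (s := Iio (cdfQuantile (coneCdf (T : Set (EuclideanSpace ℝ (Fin d)))) α)))).and
    self_mem_nhdsWithin).exists
  -- Moving strictly above `x'` gives `{‖𝐓z‖² ≤ x'} ⊆ {‖𝐓z‖² < x}`, so a possible atom at the
  -- threshold does no harm.
  obtain ⟨x, hxx', hx⟩ := exists_between hlt
  refine ⟨x, hx, ?_⟩
  have hm : MeasurableSet {z : EuclideanSpace ℝ (Fin d) | ‖metricProj T z‖ ^ 2 < x} :=
    measurableSet_lt ((continuous_metricProj T).norm.pow 2).measurable measurable_const
  have hcompl : {z : EuclideanSpace ℝ (Fin d) | x ≤ ‖metricProj T z‖ ^ 2}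
      = {z | ‖metricProj T z‖ ^ 2 < x}ᶜ := by
    ext z
    simp
  have hmono : coneCdf (T : Set (EuclideanSpace ℝ (Fin d))) x'
      ≤ (stdGaussian (EuclideanSpace ℝ (Fin d))).real {z | ‖metricProj T z‖ ^ 2 < x} :=
    measureReal_mono fun z hz => lt_of_le_of_lt hz hxx'
  rw [ENNReal.lt_ofReal_iff_toReal_lt (measure_ne_top _ _), ← measureReal_def, hcompl,
    probReal_compl_eq_one_sub hm]
  linarith

theorem exists_quantile_lt_measure_lt (hα : α ∈ Ioo (0 : ℝ) 1)
    (hcont : ContinuousAt (coneCdf (T : Set (EuclideanSpace ℝ (Fin d))))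
      (cdfQuantile (coneCdf (T : Set (EuclideanSpace ℝ (Fin d)))) α)) {b : ℝ≥0∞}
    (hb : ENNReal.ofReal α < b) :
    ∃ x > cdfQuantile (coneCdf (T : Set (EuclideanSpace ℝ (Fin d)))) α,
      (stdGaussian (EuclideanSpace ℝ (Fin d))) {z | ‖metricProj T z‖ ^ 2 ≤ x} < b := by
  have h1 := (ENNReal.continuous_ofReal.tendsto _).comp hcont.tendsto
  rw [coneCdf_quantile T hα hcont] at h1
  have h := h1.eventually (gt_mem_nhds hb)
  obtain ⟨x, hx, hlt⟩ := ((h.filter_mono (nhdsWithin_le_nhds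
    (s := Ioi (cdfQuantile (coneCdf (T : Set (EuclideanSpace ℝ (Fin d)))) α)))).and
    self_mem_nhdsWithin).exists
  refine ⟨x, hlt, ?_⟩
  rwa [Function.comp_apply, coneCdf, measureReal_def, ENNReal.ofReal_toReal (measure_ne_top _ _)]
    at hx

end Coverage

end MCConf

/-! ### The coverage theorem. -/

open MCConf in
theorem theoremt {Ω 𝒳 Θ : Type*} [MeasurableSpace Ω] [MeasurableSpace 𝒳] [MeasurableSpace Θ]
    (P : Measure Ω) [IsProbabilityMeasure P]
    -- data, population criterion, sample criterion, prior
    (X : ℕ → Ω → 𝒳) (hX : ∀ i, Measurable (X i))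
    (L : Θ → ℝ) (hL : BddAbove (range L)) (hI : (identifiedSet L).Nonempty)
    (crit : (n : ℕ) → (Fin n → 𝒳) → Θ → ℝ)
    (hcrit : ∀ n, Measurable (Function.uncurry (crit n)))
    (prior : Measure Θ) (hprior : prior ≠ 0)
    (θhat : ℕ → Ω → Θ)
    -- local reduced-form parameter, local neighborhoods, cone
    (d : ℕ) (hd : 1 ≤ d) (ΘN : Set Θ) (γ : Θ → EuclideanSpace ℝ (Fin d))
    (Γ : Set (EuclideanSpace ℝ (Fin d))) (T : ProperCone ℝ (EuclideanSpace ℝ (Fin d)))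
    (Θosn : ℕ → Set Θ)
    (hγ : IsLocalReparam (identifiedSet L) ΘN γ Γ)
    (hosn : IsLocalNhds prior (identifiedSet L) ΘN γ T Θosn)
    -- assumptions, with limiting covariance matrix equal to the identity
    (hrate : PosteriorContraction P prior (criterion X crit) θhat Θosn)
    (hquad : LocalQuadraticApprox P X crit γ T Θosn 1)
    (hpri : PriorCondition P prior (criterion X crit) ΘN γ Γ)
    -- level, Monte Carlo draws and critical value
    (α : ℝ) (hα : α ∈ Ioo (0 : ℝ) 1)
    (B : ℕ → ℕ) (hB : ∀ n, 0 < B n) (draw : (n : ℕ) → Ω → Fin (B n) → Θ)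
    (ζ : ℕ → Ω → ℝ)
    (hζ : ∀ n ω, IsSampleQuantile (1 - α) (fun b => criterion X crit n ω (draw n ω b)) (ζ n ω))
    (hmc : MCConvergence P prior (criterion X crit) θhat ζ α)
    (hcont : ContinuousAt (coneCdf (T : Set (EuclideanSpace ℝ (Fin d))))
      (cdfQuantile (coneCdf (T : Set (EuclideanSpace ℝ (Fin d)))) α)) :
    ENNReal.ofReal α ≤ liminf (fun n => innerProb P
        {ω | identifiedSet L ⊆ confidenceSet (criterion X crit) ζ n ω}) atTop ∧
    ((T : Set (EuclideanSpace ℝ (Fin d))) = univ →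
      Tendsto (fun n => P {ω | identifiedSet L ⊆ confidenceSet (criterion X crit) ζ n ω})
        atTop (𝓝 (ENNReal.ofReal α)) ∧
      Tendsto (fun n => innerProb P
          {ω | identifiedSet L ⊆ confidenceSet (criterion X crit) ζ n ω})
        atTop (𝓝 (ENNReal.ofReal α))) := by
  have : NeZero prior := ⟨hprior⟩
  -- Inner probability is one minus the outer measure of non-coverage, which is what the lower bound
  -- controls.
  have hlow : ∀ a < ENNReal.ofReal α, ∀ᶠ n in atTop, a < innerProb P
      {ω | identifiedSet L ⊆ confidenceSet (criterion X crit) ζ n ω} := fun a ha => by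
    have haT : a ≠ ∞ := ne_top_of_lt ha
    have ha' : a.toReal < α := (ENNReal.lt_ofReal_iff_toReal_lt haT).1 ha
    obtain ⟨x, hx, hxβ⟩ := exists_lt_quantile_measure_lt (T := T) hα hcont
      (sub_lt_sub_left ha' 1)
    filter_upwards [eventually_measure_not_subset_lt hI hcrit hγ hosn hrate hquad hpri hα hmc hcont
      hx hxβ] with n hn
    rw [ENNReal.ofReal_sub _ ENNReal.toReal_nonneg, ENNReal.ofReal_one,
      ENNReal.ofReal_toReal haT] at hn
    rw [innerProb]
    exact lt_tsub_comm.1 hn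
  refine ⟨le_of_forall_lt fun a ha => ?_, fun hT => ?_⟩
  · obtain ⟨a', haa', ha'⟩ := exists_between ha
    exact haa'.trans_le (le_liminf_of_le (by isBoundedDefault)
      ((hlow a' ha').mono fun n hn => hn.le))
  · have hup : ∀ b > ENNReal.ofReal α, ∀ᶠ n in atTop,
        P {ω | identifiedSet L ⊆ confidenceSet (criterion X crit) ζ n ω} < b := fun b hb => by
      obtain ⟨x, hx, hxb⟩ := exists_quantile_lt_measure_lt (T := T) hα hcont hb
      exact eventually_measure_subset_lt hd hI hcrit hγ hosn hrate hquad hpri hα hmc hcont hT hx hxb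
    -- The lower bound holds for the inner and the upper bound for the outer probability; as inner
    -- is at most outer, both converge.
    exact ⟨tendsto_order.2 ⟨fun a ha => (hlow a ha).mono fun n hn => hn.trans_le (innerProb_le _),
      hup⟩, tendsto_order.2 ⟨hlow, fun b hb => (hup b hb).mono fun n hn =>
      (innerProb_le _).trans_lt hn⟩⟩
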